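/- Let $\mathcal{J}^2=\mathbb{R}\times\mathbb{R}^n\times\mathcal{S}(n)$ be the space of 2-jets, where $\mathcal{S}(n)$ is the space of real symmetric $n\times n$ matrices. A *subequation* is a set $\mathcal{F}\subset\mathcal{J}^2$ with $\emptyset\ne\mathcal{F}\ne\mathcal{J}^2$ such that: $(r,p,A)\in\mathcal{F}$ and $P\ge 0$ imply $(r,p,A+P)\in\mathcal{F}$; $(r,p,A)\in\mathcal{F}$ and $s\le 0$ imply $(r+s,p,A)\in\mathcal{F}$; and $\mathcal{F}=\overline{\operatorname{Int}\mathcal{F}}$. Its dual is $\widetilde{\mathcal{F}}=-(\mathcal{J}^2\setminus\operatorname{Int}\mathcal{F})$. For $S\subset\mathbb{R}^n$, let $\mathrm{USC}(S)$ (resp. $\mathrm{LSC}(S)$) be the set of upper (resp. lower) semicontinuous functions on $S$ with values in $[-\infty,\infty)$ (resp. $(-\infty,\infty]$). For $\mathcal{G}\subset\mathcal{J}^2$ and $X\subset\mathbb{R}^n$ open, $u\in\mathrm{USC}(X)$ is *$\mathcal{G}$-subharmonic on $X$* if for every $x_0\in X$ and every function $\varphi$ that is $C^2$ near $x_0$ with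 $u\le\varphi$ near $x_0$ and $u(x_0)=\varphi(x_0)$, one has $J^2_{x_0}\varphi=(\varphi(x_0),D\varphi(x_0),D^2\varphi(x_0))\in\mathcal{G}$. A function $w$ is *$\mathcal{F}$-superharmonic on $X$* if $-w$ is $\widetilde{\mathcal{F}}$-subharmonic on $X$. **Theorem (General Comparison Theorem).** Let $\mathcal{F}\subset\mathcal{J}^2$ be a subequation, and let $\mathcal{M}\subset\mathcal{J}^2$ be a subequation which is a convex cone with vertex at the origin, such that $\mathcal{F}+\mathcal{M}\subset\mathcal{F}$. Let $\Omega\subset\mathbb{R}^n$ be a bounded open set, and suppose that $\mathcal{M}$ admits a strict approximator on $\Omega$, that is, there is $\psi\in C(\overline\Omega)\cap C^2(\Omega)$ with $J^2_x\psi\in\operatorname{Int}\mathcal{M}$ for every $x\in\Omega$. Then comparison holds for $\mathcal{F}$ on $\overline\Omega$, in both of its equivalent forms: 1. if $u,v\in\mathrm{USC}(\overline\Omega)$, $u$ is $\mathcal{F}$-subharmonic on $\Omega$, $v$ is $\widetilde{\mathcal{F}}$-subharmonic on $\Omega$, and $u+v\le 0$ on $\partial\Omega$, then $u+v\le 0$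 on $\Omega$; 2. if $u\in\mathrm{USC}(\overline\Omega)$ is $\mathcal{F}$-subharmonic on $\Omega$, $w\in\mathrm{LSC}(\overline\Omega)$ is $\mathcal{F}$-superharmonic on $\Omega$, and $u\le w$ on $\partial\Omega$, then $u\le w$ on $\Omega$. -/

import Mathlib

open Filter Topology
open scoped Pointwise

noncomputable section

namespace JetTheory

/-- The space `ℝⁿ` with its Euclidean structure. -/
abbrev Euc (n : ℕ) : Type := EuclideanSpace ℝ (Fin n)

/-- The space of symmetric `n × n` matrices with real entries. -/
def symMatrix (n : ℕ) : Submodule ℝ (Matrix (Fin n) (Fin n) ℝ) where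
  carrier := {A | A.IsSymm}
  add_mem' := fun hA hB => Matrix.IsSymm.add hA hB
  zero_mem' := Matrix.isSymm_zero
  smul_mem' := fun c _ hA => Matrix.IsSymm.smul hA c

/-- The space of 2-jets `(r, p, A)`, with its usual vector space structure and topology. -/
abbrev Jet (n : ℕ) : Type := ℝ × Euc n × symMatrix n

/-- A (constant coefficient) subequation constraint set: a non-empty proper subset of the 2-jet
space satisfying positivity (P), negativity (N) and the topological condition (T). -/
structure IsSubequation {n : ℕ} (F : Set (Jet n)) : Prop where
  nonempty : F.Nonempty
  proper : F ≠ Set.univ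
  pos : ∀ (r : ℝ) (p : Euc n) (A P : symMatrix n), (r, p, A) ∈ F →
    (P : Matrix (Fin n) (Fin n) ℝ).PosSemidef → (r, p, A + P) ∈ F
  neg : ∀ (r s : ℝ) (p : Euc n) (A : symMatrix n), (r, p, A) ∈ F → s ≤ 0 → (r + s, p, A) ∈ F
  top : F = closure (interior F)

/-- A convex cone subequation: a subequation which is a convex cone with vertex at the origin. -/
structure IsConvexConeSubequation {n : ℕ} (M : Set (Jet n)) : Prop where
  subequation : IsSubequation M
  convex : Convex ℝ M
  cone : ∀ t : ℝ, 0 ≤ t → ∀ J ∈ M, t • J ∈ M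

/-- `F` is `M`-monotone: `F + M ⊆ F`. -/
def IsMonotoneFor {n : ℕ} (F M : Set (Jet n)) : Prop := F + M ⊆ F

/-- The Dirichlet dual `-(∼ Int F)`. -/
def dual {n : ℕ} (F : Set (Jet n)) : Set (Jet n) := -(interior F)ᶜ

/-- The matrix of second derivatives of `φ` at `x`. -/
def hessianMatrix {n : ℕ} (φ : Euc n → ℝ) (x : Euc n) : Matrix (Fin n) (Fin n) ℝ :=
  Matrix.of fun i j =>
    fderiv ℝ (fderiv ℝ φ) x (EuclideanSpace.single i 1) (EuclideanSpace.single j 1)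

/-- The second derivative as an element of the space of symmetric matrices. The symmetrization
only serves to make it a total function: at a point where `φ` is `C²` it changes nothing, see
`coe_hessian`. -/
def hessian {n : ℕ} (φ : Euc n → ℝ) (x : Euc n) : symMatrix n :=
  ⟨(2⁻¹ : ℝ) • (hessianMatrix φ x + (hessianMatrix φ x).transpose), by
    show Matrix.IsSymm _
    simp [Matrix.IsSymm, add_comm]⟩

theorem coe_hessian {n : ℕ} {φ : Euc n → ℝ} {x : Euc n} (h : ContDiffAt ℝ 2 φ x) :
    (hessian φ x : Matrix (Fin n) (Fin n) ℝ) = hessianMatrix φ x := by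
  have hs : IsSymmSndFDerivAt ℝ φ x := h.isSymmSndFDerivAt (by simp)
  ext i j
  have := hs (EuclideanSpace.single i 1) (EuclideanSpace.single j 1)
  simp only [hessian, hessianMatrix, Matrix.smul_apply, Matrix.add_apply, Matrix.transpose_apply,
    Matrix.of_apply, smul_eq_mul]
  rw [this]
  ring

/-- The 2-jet `(φ(x), Dφ(x), D²φ(x))` of a function that is `C²` near `x`. -/
def jet {n : ℕ} (φ : Euc n → ℝ) (x : Euc n) : Jet n := (φ x, gradient φ x, hessian φ x)

/-- `u ∈ USC(S)`: upper semicontinuous on `S`, with values in `[-∞, ∞)`. -/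
def IsUSC {n : ℕ} (S : Set (Euc n)) (u : Euc n → EReal) : Prop :=
  UpperSemicontinuousOn u S ∧ ∀ x ∈ S, u x < ⊤

/-- `w ∈ LSC(S)`: lower semicontinuous on `S`, with values in `(-∞, ∞]`. -/
def IsLSC {n : ℕ} (S : Set (Euc n)) (w : Euc n → EReal) : Prop :=
  LowerSemicontinuousOn w S ∧ ∀ x ∈ S, ⊥ < w x

/-- `φ` is a `C²` upper test function for `u` at `x₀`. -/
def IsUpperTest {n : ℕ} (u : Euc n → EReal) (x₀ : Euc n) (φ : Euc n → ℝ) : Prop :=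
  ContDiffAt ℝ 2 φ x₀ ∧ (∀ᶠ x in 𝓝 x₀, u x ≤ (φ x : EReal)) ∧ u x₀ = (φ x₀ : EReal)

/-- `u` is `F`-subharmonic on the open set `X` (in the viscosity sense). -/
def IsSubharmonicOn {n : ℕ} (F : Set (Jet n)) (X : Set (Euc n)) (u : Euc n → EReal) : Prop :=
  IsUSC X u ∧ ∀ x₀ ∈ X, ∀ φ : Euc n → ℝ, IsUpperTest u x₀ φ → jet φ x₀ ∈ F

/-- `w` is `F`-superharmonic on `X`: `-w` is subharmonic for the dual of `F`. -/
def IsSuperharmonicOn {n : ℕ} (F : Set (Jet n)) (X : Set (Euc n)) (w : Euc n → EReal) : Prop :=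
  IsSubharmonicOn (dual F) X (fun x => -w x)

/-- `ψ ∈ C(Ω̄) ∩ C²(Ω)` with `J²ψ ∈ Int M` everywhere on `Ω`. -/
def IsStrictApproximator {n : ℕ} (M : Set (Jet n)) (Ω : Set (Euc n)) (ψ : Euc n → ℝ) : Prop :=
  ContinuousOn ψ (closure Ω) ∧ ContDiffOn ℝ 2 ψ Ω ∧ ∀ x ∈ Ω, jet ψ x ∈ interior M

end JetTheory

end

/-! If u + v were positive somewhere, then for small ε > 0 the function u + v + εψ would attain its
maximum over the compact closure at an interior point x₀, with nonnegative value. Near x₀ the sum u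
+ v then lies below a constant minus εψ, and minus the jet of this bound at x₀ is ε J²ψ plus (a
nonpositive number, 0, 0), a point of Int M. Subharmonic addition
(`neg_notMem_interior_of_touching`) forbids this: if u and v had contact jets J ∈ F and K ∈ `dual F`
there with -(J + K) ∈ Int M, then -K = J - (J + K) ∈ F + Int M ⊆ Int F, against K ∈ `dual F`.

As u and v are only upper semicontinuous, the jets come from a theorem on sums
(`exists_contact_of_sum`). Sup-convolution makes both functions semiconvex, and its contact
quadratics translate back to the original functions. For two semiconvex functions,
`exists_second_order_maximum` replaces each by a C^{1,1} envelope that agrees with it at the maximum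
points. At the maximum point for the tilt p the two envelope gradients add up to p, so a Lipschitz
map carries the maximum points onto a ball of tilts. By Rademacher the points where a gradient is
not differentiable form a null set, whose Lipschitz image is null; some maximum point therefore
avoids it and has second order expansions. The tilt, the displacement of the points and the slack in
the Hessians are small, and openness of Int M absorbs them. -/

namespace JetTheory

/-! ### Semiconvex functions and envelopes by paraboloids. -/

section Semiconvex

variable {E : Type*} [NormedAddCommGroup E] [InnerProductSpace ℝ E]

/-- `f` is semiconvex with constant `K`: the function `f + K/2 ‖·‖²` is convex. -/
def SemiconvexWith (K : ℝ) (f : E → ℝ) : Prop :=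
  ∀ (a b : E) (s t : ℝ), 0 ≤ s → 0 ≤ t → s + t = 1 →
    f (s • a + t • b) ≤ s * f a + t * f b + K / 2 * (s * t) * ‖a - b‖ ^ 2

theorem norm_sq_convex_combination (a b : E) {s t : ℝ} (h : s + t = 1) :
    ‖s • a + t • b‖ ^ 2 = s * ‖a‖ ^ 2 + t * ‖b‖ ^ 2 - s * t * ‖a - b‖ ^ 2 := by
  obtain rfl : t = 1 - s := by linarith
  rw [norm_add_sq_real, norm_sub_sq_real, norm_smul, norm_smul, real_inner_smul_left,
    real_inner_smul_right, mul_pow, mul_pow, Real.norm_eq_abs, Real.norm_eq_abs, sq_abs, sq_abs]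
  ring

theorem SemiconvexWith.convexOn {K : ℝ} {f : E → ℝ} (hf : SemiconvexWith K f) :
    ConvexOn ℝ Set.univ fun x => f x + K / 2 * ‖x‖ ^ 2 := by
  refine ⟨convex_univ, fun a _ b _ s t hs ht hst => ?_⟩
  have := hf a b s t hs ht hst
  simp only [smul_eq_mul]
  rw [norm_sq_convex_combination a b hst]
  linarith

theorem SemiconvexWith.add {K L : ℝ} {f g : E → ℝ} (hf : SemiconvexWith K f)
    (hg : SemiconvexWith L g) : SemiconvexWith (K + L) fun x => f x + g x := by
  intro a b s t hs ht hst
  have h1 := hf a b s t hs ht hst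
  have h2 := hg a b s t hs ht hst
  dsimp only
  linarith

theorem SemiconvexWith.mono {K L : ℝ} {f : E → ℝ} (hf : SemiconvexWith K f) (h : K ≤ L) :
    SemiconvexWith L f := by
  intro a b s t hs ht hst
  have h1 := hf a b s t hs ht hst
  have : K / 2 * (s * t) * ‖a - b‖ ^ 2 ≤ L / 2 * (s * t) * ‖a - b‖ ^ 2 := by gcongr
  linarith

theorem semiconvexWith_affine (c : ℝ) (p : E) : SemiconvexWith 0 fun x => c + inner ℝ p x := by
  intro a b s t _ _ hst
  obtain rfl : t = 1 - s := by linarith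
  simp only [inner_add_right, real_inner_smul_right]
  linarith

theorem mul_norm_sq_eq_add (K : ℝ) (x y : E) :
    K / 2 * ‖y‖ ^ 2 = K / 2 * ‖x‖ ^ 2 + inner ℝ (K • x) (y - x) + K / 2 * ‖y - x‖ ^ 2 := by
  rw [norm_sub_sq_real, real_inner_smul_left, inner_sub_right, real_inner_self_eq_norm_sq,
    real_inner_comm x y]
  ring

/-- The paraboloid `y ↦ c + ⟨b, y⟩ + K/2 ‖y‖²`. -/
noncomputable def paraboloid (K : ℝ) (q : ℝ × E) (y : E) : ℝ := q.1 + inner ℝ q.2 y + K / 2 * ‖y‖ ^ 2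

/-- The infimum of the paraboloids of opening `K` lying above `f`. -/
noncomputable def upperEnvelope (K : ℝ) (f : E → ℝ) (x : E) : ℝ :=
  ⨅ q : {q : ℝ × E // ∀ y, f y ≤ paraboloid K q y}, paraboloid K q.1 x

theorem upperEnvelope_le_paraboloid {K : ℝ} {f : E → ℝ} {q : ℝ × E}
    (hq : ∀ y, f y ≤ paraboloid K q y) (x : E) : upperEnvelope K f x ≤ paraboloid K q x :=
  ciInf_le ⟨f x, by rintro _ ⟨r, rfl⟩; exact r.2 x⟩
    (⟨q, hq⟩ : {q : ℝ × E // ∀ y, f y ≤ paraboloid K q y})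

theorem le_upperEnvelope_of_forall {K : ℝ} {f : E → ℝ}
    (hne : ∃ q : ℝ × E, ∀ y, f y ≤ paraboloid K q y) {x : E} {c : ℝ}
    (h : ∀ q : ℝ × E, (∀ y, f y ≤ paraboloid K q y) → c ≤ paraboloid K q x) :
    c ≤ upperEnvelope K f x := by
  have : Nonempty {q : ℝ × E // ∀ y, f y ≤ paraboloid K q y} := hne.elim fun q hq => ⟨q, hq⟩
  exact le_ciInf fun q => h q.1 q.2

theorem exists_paraboloid_lt {K : ℝ} {f : E → ℝ}
    (hne : ∃ q : ℝ × E, ∀ y, f y ≤ paraboloid K q y) (x : E) {ε : ℝ} (hε : 0 < ε) :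
    ∃ q : ℝ × E, (∀ y, f y ≤ paraboloid K q y) ∧ paraboloid K q x < upperEnvelope K f x + ε := by
  by_contra! h
  linarith [le_upperEnvelope_of_forall hne h]

theorem le_upperEnvelope {K : ℝ} {f : E → ℝ}
    (hne : ∃ q : ℝ × E, ∀ y, f y ≤ paraboloid K q y) (x : E) : f x ≤ upperEnvelope K f x :=
  le_upperEnvelope_of_forall hne fun _ hq => hq x

/-- An infimum of paraboloids of opening `K` inherits their semiconcavity. -/
theorem semiconvexWith_neg_upperEnvelope {K : ℝ} {f : E → ℝ}
    (hne : ∃ q : ℝ × E, ∀ y, f y ≤ paraboloid K q y) :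
    SemiconvexWith K fun x => -upperEnvelope K f x := by
  intro a b s t hs ht hst
  have key : s * upperEnvelope K f a + t * upperEnvelope K f b - K / 2 * (s * t) * ‖a - b‖ ^ 2
      ≤ upperEnvelope K f (s • a + t • b) := by
    refine le_upperEnvelope_of_forall hne fun q hq => ?_
    have h1 := mul_le_mul_of_nonneg_left (upperEnvelope_le_paraboloid hq a) hs
    have h2 := mul_le_mul_of_nonneg_left (upperEnvelope_le_paraboloid hq b) ht
    simp only [paraboloid] at h1 h2 ⊢
    rw [norm_sq_convex_combination a b hst, inner_add_right, real_inner_smul_right,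
      real_inner_smul_right]
    obtain rfl : t = 1 - s := by linarith
    linarith
  linarith

/-- Nearly optimal paraboloids at `a` and `b`, translated to the intermediate point and averaged,
again lie above `f` because `f` is semiconvex. With the previous bound this makes the envelope
C^{1,1}. -/
theorem SemiconvexWith.upperEnvelope {K : ℝ} {f : E → ℝ} (hf : SemiconvexWith K f)
    (hne : ∃ q : ℝ × E, ∀ y, f y ≤ paraboloid K q y) :
    SemiconvexWith K (upperEnvelope K f) := by
  intro a b s t hs ht hst
  refine le_of_forall_pos_lt_add fun ε hε => ?_
  obtain ⟨q, hq, hqa⟩ := exists_paraboloid_lt hne a hε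
  obtain ⟨r, hr, hrb⟩ := exists_paraboloid_lt hne b hε
  obtain ⟨x, hx⟩ : ∃ x, x = s • a + t • b := ⟨_, rfl⟩
  -- The average of the two translates plus the semiconvexity error. Since `s • (a - x) + t • (b -
  -- x) = 0`, the cross terms cancel and no new linear part appears; since `s + t = 1`, the opening
  -- stays `K`.
  let m : ℝ × E := (s * (q.1 + inner ℝ q.2 (a - x) + K / 2 * ‖a - x‖ ^ 2) +
    t * (r.1 + inner ℝ r.2 (b - x) + K / 2 * ‖b - x‖ ^ 2) + K / 2 * (s * t) * ‖a - b‖ ^ 2,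
    s • q.2 + t • r.2)
  have hz : s • (a - x) + t • (b - x) = 0 := by
    rw [smul_sub, smul_sub, sub_add_sub_comm, ← add_smul, hst, one_smul, hx, sub_self]
  have hm : ∀ y, paraboloid K m y = s * paraboloid K q (y + (a - x)) +
      t * paraboloid K r (y + (b - x)) + K / 2 * (s * t) * ‖a - b‖ ^ 2 := by
    intro y
    have h0 : s * inner ℝ y (a - x) + t * inner ℝ y (b - x) = 0 := by
      rw [← real_inner_smul_right, ← real_inner_smul_right, ← inner_add_right, hz, inner_zero_right]
    simp only [paraboloid, m, inner_add_left, real_inner_smul_left, inner_add_right]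
    rw [norm_add_sq_real, norm_add_sq_real]
    obtain rfl : t = 1 - s := by linarith
    linear_combination (-K) * h0
  have hfm : ∀ y, f y ≤ paraboloid K m y := by
    intro y
    have h := hf (y + (a - x)) (y + (b - x)) s t hs ht hst
    have h1 : s • (y + (a - x)) + t • (y + (b - x)) = y := by
      rw [smul_add, smul_add, add_add_add_comm, hz, ← add_smul, hst, one_smul, add_zero]
    have h2 : y + (a - x) - (y + (b - x)) = a - b := by abel
    rw [h1, h2] at h
    rw [hm]
    have h3 := mul_le_mul_of_nonneg_left (hq (y + (a - x))) hs
    have h4 := mul_le_mul_of_nonneg_left (hr (y + (b - x))) ht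
    linarith
  have h5 := upperEnvelope_le_paraboloid hfm x
  rw [hm, add_sub_cancel, add_sub_cancel] at h5
  rw [← hx]
  have h6 : s * paraboloid K q a + t * paraboloid K r b <
      s * JetTheory.upperEnvelope K f a + t * JetTheory.upperEnvelope K f b + ε := by
    obtain rfl : t = 1 - s := by linarith
    rcases hs.eq_or_lt with rfl | hs
    · linarith
    · nlinarith
  linarith

variable [FiniteDimensional ℝ E]

theorem SemiconvexWith.continuous {K : ℝ} {f : E → ℝ} (hf : SemiconvexWith K f) :
    Continuous f := by
  have h : Continuous fun x => f x + K / 2 * ‖x‖ ^ 2 := hf.convexOn.locallyLipschitz.continuous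
  have : f = fun x => (f x + K / 2 * ‖x‖ ^ 2) - K / 2 * ‖x‖ ^ 2 := by ext; ring
  rw [this]
  fun_prop

/-- A finite convex function has a subgradient at every point. -/
theorem exists_subgradient {g : E → ℝ} (hg : ConvexOn ℝ Set.univ g) (x : E) :
    ∃ p : E, ∀ y, g x + inner ℝ p (y - x) ≤ g y := by
  have hc : Continuous g := hg.locallyLipschitz.continuous
  have hopen : IsOpen {q : E × ℝ | q.1 ∈ Set.univ ∧ g q.1 < q.2} := by
    simp only [Set.mem_univ, true_and]
    exact isOpen_lt (hc.comp continuous_fst) continuous_snd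
  obtain ⟨L, hL⟩ := geometric_hahn_banach_open_point (x := (x, g x)) hg.convex_strict_epigraph hopen
    (by simp)
  have hsplit : ∀ y t, L (y, t) = L (y, 0) + t * L (0, 1) := by
    intro y t
    have : (y, t) = (y, (0 : ℝ)) + t • ((0 : E), (1 : ℝ)) := by simp
    rw [this, map_add, map_smul, smul_eq_mul]
  -- The separating hyperplane is not vertical: raising `(x, g x)` lands in the strict epigraph.
  have hneg : L (0, 1) < 0 := by
    have := hL (x, g x + 1) ⟨trivial, by simp⟩
    rw [hsplit x (g x + 1), hsplit x (g x)] at this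
    linarith
  have hle : ∀ y, L (y, 0) + g y * L (0, 1) ≤ L (x, 0) + g x * L (0, 1) := by
    intro y
    refine le_of_forall_pos_lt_add fun ε hε => ?_
    have hs : 0 < ε / (-L (0, 1)) := div_pos hε (by linarith)
    have := hL (y, g y + ε / (-L (0, 1))) ⟨trivial, by simpa using hs⟩
    rw [hsplit y, hsplit x (g x), add_mul, div_mul_eq_mul_div] at this
    have h2 : ε * L (0, 1) / (-L (0, 1)) = -ε := by field_simp [hneg.ne]
    linarith
  let l : E →L[ℝ] ℝ := (-L (0, 1))⁻¹ • (L.comp (ContinuousLinearMap.inl ℝ E ℝ))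
  refine ⟨(InnerProductSpace.toDual ℝ E).symm l, fun y => ?_⟩
  rw [InnerProductSpace.toDual_symm_apply]
  have hl : l (y - x) = (-L (0, 1))⁻¹ * (L (y, 0) - L (x, 0)) := by
    simp only [l, map_sub]
    simp
    ring
  rw [hl]
  have h3 : L (y, 0) - L (x, 0) ≤ (g y - g x) * (-L (0, 1)) := by linarith [hle y]
  have h4 : (-L (0, 1))⁻¹ * (L (y, 0) - L (x, 0)) ≤ g y - g x := by
    rw [inv_mul_le_iff₀ (by linarith)]
    linarith
  linarith

theorem SemiconvexWith.exists_subgradient {K : ℝ} {f : E → ℝ} (hf : SemiconvexWith K f) (x : E) :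
    ∃ p : E, ∀ y, f x + inner ℝ p (y - x) - K / 2 * ‖y - x‖ ^ 2 ≤ f y := by
  obtain ⟨p, hp⟩ := JetTheory.exists_subgradient hf.convexOn x
  refine ⟨p - K • x, fun y => ?_⟩
  have h1 := hp y
  have h2 := mul_norm_sq_eq_add K x y
  rw [inner_sub_left]
  linarith

theorem SemiconvexWith.exists_supergradient {K : ℝ} {f : E → ℝ}
    (hf : SemiconvexWith K fun x => -f x) (x : E) :
    ∃ p : E, ∀ y, f y ≤ f x + inner ℝ p (y - x) + K / 2 * ‖y - x‖ ^ 2 := by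
  obtain ⟨p, hp⟩ := hf.exists_subgradient x
  refine ⟨-p, fun y => ?_⟩
  have := hp y
  rw [inner_neg_left]
  linarith

theorem SemiconvexWith.exists_paraboloid {K : ℝ} {f : E → ℝ}
    (hf : SemiconvexWith K fun x => -f x) (x : E) :
    ∃ q : ℝ × E, (∀ y, f y ≤ paraboloid K q y) ∧ paraboloid K q x = f x := by
  obtain ⟨p, hp⟩ := hf.exists_supergradient x
  refine ⟨(f x - inner ℝ p x + K / 2 * ‖x‖ ^ 2, p - K • x), fun y => ?_, ?_⟩
  · refine (hp y).trans (le_of_eq ?_)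
    have h2 := mul_norm_sq_eq_add K x y
    have h3 : inner ℝ (K • x) x = K * ‖x‖ ^ 2 := by
      rw [real_inner_smul_left, real_inner_self_eq_norm_sq]
    simp only [paraboloid, inner_sub_left, inner_sub_right] at h2 ⊢
    linarith
  · have h3 : inner ℝ (K • x) x = K * ‖x‖ ^ 2 := by
      rw [real_inner_smul_left, real_inner_self_eq_norm_sq]
    simp only [paraboloid, inner_sub_left]
    linarith

/-- A semiconcave `w` is touched from above at each point by a paraboloid of opening `K`, which
competes in the infimum. So the envelope is the least semiconcave majorant. -/
theorem upperEnvelope_le {K : ℝ} {f w : E → ℝ} (hw : SemiconvexWith K fun x => -w x)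
    (hfw : ∀ y, f y ≤ w y) (x : E) : upperEnvelope K f x ≤ w x := by
  obtain ⟨q, hq, hx⟩ := hw.exists_paraboloid x
  rw [← hx]
  exact upperEnvelope_le_paraboloid (fun y => (hfw y).trans (hq y)) x

end Semiconvex

/-! ### C^{1,1} regularity and second order expansions. -/

section Semiconvex

variable {E : Type*} [NormedAddCommGroup E] [InnerProductSpace ℝ E]

/-- Compare the bounds at `y + w`, where `w` has the direction of `G x - G y` and the length of `y -
x`. The three quadratic errors are at most 4, 1 and 1 times `L / 2 * ‖y - x‖ ^ 2`, whence the factor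
3. -/
theorem norm_sub_le_of_quadratic_bounds {L : ℝ} {h : E → ℝ} {G : E → E}
    (hlow : ∀ x y, h x + inner ℝ (G x) (y - x) - L / 2 * ‖y - x‖ ^ 2 ≤ h y)
    (hup : ∀ x y, h y ≤ h x + inner ℝ (G x) (y - x) + L / 2 * ‖y - x‖ ^ 2) (hL : 0 ≤ L) (x y : E) :
    ‖G x - G y‖ ≤ 3 * L * ‖x - y‖ := by
  rcases eq_or_ne (G x) (G y) with hG | hG
  · rw [hG, sub_self, norm_zero]
    positivity
  have hpos : 0 < ‖G x - G y‖ := norm_pos_iff.2 (sub_ne_zero.2 hG)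
  rcases eq_or_ne x y with rfl | hxy
  · exact absurd rfl hG
  have hr : 0 < ‖y - x‖ := norm_pos_iff.2 (sub_ne_zero.2 hxy.symm)
  obtain ⟨w, hw⟩ : ∃ w, w = (‖y - x‖ / ‖G x - G y‖) • (G x - G y) := ⟨_, rfl⟩
  have hwn : ‖w‖ = ‖y - x‖ := by
    rw [hw, norm_smul, Real.norm_of_nonneg (by positivity), div_mul_cancel₀ _ hpos.ne']
  have h1 := hlow x (y + w)
  have h2 := hup y (y + w)
  have h3 := hup x y
  have h4 : ‖y + w - x‖ ≤ 2 * ‖y - x‖ := by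
    calc ‖y + w - x‖ = ‖(y - x) + w‖ := by congr 1; abel
      _ ≤ ‖y - x‖ + ‖w‖ := norm_add_le _ _
      _ = 2 * ‖y - x‖ := by rw [hwn]; ring
  have h5 : ‖y + w - x‖ ^ 2 ≤ (2 * ‖y - x‖) ^ 2 := by gcongr
  have h6 : y + w - x = (y - x) + w := by abel
  rw [add_sub_cancel_left, hwn] at h2
  have h7 : inner ℝ (G x) (y + w - x) = inner ℝ (G x) (y - x) + inner ℝ (G x) w := by
    rw [h6, inner_add_right]
  have h8 : inner ℝ (G x) w - inner ℝ (G y) w = ‖y - x‖ * ‖G x - G y‖ := by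
    rw [← inner_sub_left, hw, real_inner_smul_right, real_inner_self_eq_norm_sq]
    field_simp
  have h9 : L / 2 * ‖y + w - x‖ ^ 2 ≤ L / 2 * (2 * ‖y - x‖) ^ 2 := by gcongr
  have h10 : ‖y - x‖ * ‖G x - G y‖ ≤ ‖y - x‖ * (3 * L * ‖y - x‖) := by
    linarith
  rw [norm_sub_rev x y]
  exact le_of_mul_le_mul_left h10 hr

theorem eq_of_inner_le_quadratic {p q : E} {L : ℝ}
    (h : ∀ z : E, inner ℝ p z - L / 2 * ‖z‖ ^ 2 ≤ inner ℝ q z + L / 2 * ‖z‖ ^ 2) : p = q := by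
  by_contra hpq
  have hpos : 0 < ‖p - q‖ ^ 2 := by
    have : 0 < ‖p - q‖ := norm_pos_iff.2 (sub_ne_zero.2 hpq)
    positivity
  have h1 := h ((1 / (2 * (|L| + 1))) • (p - q))
  have h2 : (1 / (2 * (|L| + 1))) * ‖p - q‖ ^ 2 ≤ L * ((1 / (2 * (|L| + 1))) ^ 2 * ‖p - q‖ ^ 2) := by
    rw [norm_smul, mul_pow, Real.norm_eq_abs, sq_abs, real_inner_smul_right,
      real_inner_smul_right] at h1
    have h0 : ‖p - q‖ ^ 2 = inner ℝ p (p - q) - inner ℝ q (p - q) := by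
      rw [← inner_sub_left, real_inner_self_eq_norm_sq]
    rw [h0] at h1 ⊢
    linarith
  have h3 : L ≤ |L| := le_abs_self L
  have h4 : (1 : ℝ) / (2 * (|L| + 1)) ≤ L * (1 / (2 * (|L| + 1))) ^ 2 := by
    nlinarith
  have h5 : 0 < |L| + 1 := by positivity
  rw [div_pow, one_pow, mul_one_div, div_le_div_iff₀ (by positivity) (by positivity)] at h4
  nlinarith

theorem hasFDerivAt_of_quadratic_bounds [CompleteSpace E] {L : ℝ} {h : E → ℝ} {p x : E}
    (hlow : ∀ y, h x + inner ℝ p (y - x) - L / 2 * ‖y - x‖ ^ 2 ≤ h y)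
    (hup : ∀ y, h y ≤ h x + inner ℝ p (y - x) + L / 2 * ‖y - x‖ ^ 2) :
    HasFDerivAt h (innerSL ℝ p) x := by
  rw [hasFDerivAt_iff_isLittleO]
  have : (fun y => h y - h x - innerSL ℝ p (y - x)) =O[𝓝 x] fun y => ‖y - x‖ ^ 2 := by
    refine Asymptotics.IsBigO.of_bound (L / 2) (Eventually.of_forall fun y => ?_)
    rw [Real.norm_eq_abs, abs_le, Real.norm_of_nonneg (by positivity), innerSL_apply_apply]
    constructor <;> linarith [hlow y, hup y]
  refine this.trans_isLittleO ?_
  have h2 : (fun z : E => ‖z‖ ^ 2) =o[𝓝 0] fun z => z := by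
    simpa using (Asymptotics.isLittleO_norm_pow_id (E' := E) (one_lt_two))
  have h3 : Tendsto (fun y => y - x) (𝓝 x) (𝓝 0) := by
    have : Continuous fun y : E => y - x := by fun_prop
    simpa using this.tendsto x
  exact h2.comp_tendsto h3

/-- A function which is both semiconvex and semiconcave is `C^{1,1}`. -/
theorem SemiconvexWith.exists_lipschitz_gradient [FiniteDimensional ℝ E] {K : ℝ} (hK : 0 ≤ K)
    {h : E → ℝ} (h1 : SemiconvexWith K h) (h2 : SemiconvexWith K fun x => -h x) :
    ∃ G : E → E, LipschitzWith (3 * K).toNNReal G ∧ ∀ x, HasFDerivAt h (innerSL ℝ (G x)) x := by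
  choose G hG using h1.exists_subgradient
  choose G' hG' using h2.exists_supergradient
  obtain rfl : G = G' := by
    funext x
    refine eq_of_inner_le_quadratic (L := K) fun z => ?_
    have h3 := hG x (x + z)
    have h4 := hG' x (x + z)
    rw [add_sub_cancel_left] at h3 h4
    linarith
  refine ⟨G, LipschitzWith.of_dist_le_mul fun x y => ?_, fun x =>
    hasFDerivAt_of_quadratic_bounds (hG x) (hG' x)⟩
  rw [dist_eq_norm, dist_eq_norm, Real.coe_toNNReal _ (by positivity)]
  exact norm_sub_le_of_quadratic_bounds hG hG' hK x y

/-- The second order Peano expansion at a point where the derivative is differentiable. -/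
theorem taylor_two_isLittleO {E : Type*} [NormedAddCommGroup E] [NormedSpace ℝ E] {h : E → ℝ}
    {h' : E → E →L[ℝ] ℝ} {x : E} {B : E →L[ℝ] E →L[ℝ] ℝ}
    (hd : ∀ᶠ y in 𝓝 x, HasFDerivAt h (h' y) y) (hB : HasFDerivAt h' B x) {ε : ℝ} (hε : 0 < ε) :
    ∀ᶠ y in 𝓝 x, |h y - (h x + h' x (y - x) + 2⁻¹ * B (y - x) (y - x))| ≤ ε * ‖y - x‖ ^ 2 := by
  have hsymm : ∀ v w, B v w = B w v := second_derivative_symmetric_of_eventually hd hB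
  have ho := (hasFDerivAt_iff_isLittleO.1 hB).def hε
  obtain ⟨r, hr, hball⟩ := Metric.eventually_nhds_iff_ball.1 (hd.and ho)
  filter_upwards [Metric.ball_mem_nhds x hr] with y hy
  -- By symmetry of `B`, the derivative of `R` at `z` is `h' z - h' x - B (z - x)`, which is at most
  -- `ε * ‖y - x‖` on the ball; the mean value inequality supplies the second factor `‖y - x‖`.
  let R : E → ℝ := fun z => h z - h' x (z - x) - 2⁻¹ * B (z - x) (z - x)
  have hR : ∀ z ∈ Metric.closedBall x ‖y - x‖,
      HasFDerivWithinAt R (h' z - h' x - B (z - x)) (Metric.closedBall x ‖y - x‖) z := by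
    intro z hz
    have hz' : z ∈ Metric.ball x r := by
      rw [Metric.mem_closedBall, dist_eq_norm] at hz
      rw [Metric.mem_ball, dist_eq_norm] at hy ⊢
      linarith
    have d1 := (hball z hz').1
    have d0 : HasFDerivAt (fun z => z - x) (ContinuousLinearMap.id ℝ E) z :=
      (hasFDerivAt_id z).sub_const x
    have d2 : HasFDerivAt (fun z => h' x (z - x)) (h' x) z :=
      (h' x).hasFDerivAt.comp z d0
    have d3 := (B.hasFDerivAt.comp z d0).clm_apply d0
    have d4 := (d1.sub d2).sub (d3.const_mul (2⁻¹ : ℝ))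
    refine (d4.congr_fderiv ?_).hasFDerivWithinAt
    ext w
    simp [hsymm w]
    ring
  have hbound : ∀ z ∈ Metric.closedBall x ‖y - x‖, ‖h' z - h' x - B (z - x)‖ ≤ ε * ‖y - x‖ := by
    intro z hz
    rw [Metric.mem_closedBall, dist_eq_norm] at hz
    have hz' : z ∈ Metric.ball x r := by
      rw [Metric.mem_ball, dist_eq_norm] at hy ⊢
      linarith
    exact (hball z hz').2.trans (by gcongr)
  have := (convex_closedBall x ‖y - x‖).norm_image_sub_le_of_norm_hasFDerivWithin_le hR hbound
    (x := x) (y := y) (by simp) (by simp [dist_eq_norm])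
  have e : R y - R x = h y - (h x + h' x (y - x) + 2⁻¹ * B (y - x) (y - x)) := by
    simp [R]
    ring
  rw [e, Real.norm_eq_abs] at this
  calc _ ≤ _ := this
    _ = _ := by ring

end Semiconvex

/-! ### Second order contact at a maximum of a sum. -/

section Semiconvex

open MeasureTheory

/-- The n-dimensional Hausdorff measure is a Haar measure, and Lipschitz maps increase it by at most
a constant factor. -/
theorem volume_image_eq_zero_of_lipschitzWith {n : ℕ} {C : NNReal} {G : Euc n → Euc n}
    (hG : LipschitzWith C G) {N : Set (Euc n)} (hN : volume N = 0) : volume (G '' N) = 0 := by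
  have hfr : Module.finrank ℝ (Euc n) = n := by simp
  have : (μH[(n : ℝ)] : Measure (Euc n)).IsAddHaarMeasure := by
    have := isAddHaarMeasure_hausdorffMeasure (E := Euc n)
    rwa [hfr] at this
  have h1 : (μH[(n : ℝ)] : Measure (Euc n)) N = 0 :=
    Measure.absolutelyContinuous_isAddHaarMeasure _ volume hN
  refine Measure.absolutelyContinuous_isAddHaarMeasure volume (μH[(n : ℝ)] : Measure (Euc n)) ?_
  have h2 := hG.hausdorffMeasure_image_le (d := n) (Nat.cast_nonneg n) N
  rw [h1, mul_zero] at h2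
  exact le_antisymm h2 bot_le

theorem le_zero_of_eventually_quadratic {E : Type*} [NormedAddCommGroup E] [NormedSpace ℝ E]
    {x w : E} {l : E →L[ℝ] ℝ} {b : ℝ} {B : E →L[ℝ] E →L[ℝ] ℝ}
    (h : ∀ ε > 0, ∀ᶠ y in 𝓝 x, l (y - x) + 2⁻¹ * B (y - x) (y - x) ≤ ε * ‖y - x‖ ^ 2)
    (hl : l w = 0) (hb : B w w = b) : b ≤ 0 := by
  by_contra! hpos
  have hw : w ≠ 0 := by
    rintro rfl
    simp at hb
    linarith
  have hw' : 0 < ‖w‖ := norm_pos_iff.2 hw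
  have he := h (b / (4 * ‖w‖ ^ 2)) (by positivity)
  have ht : Tendsto (fun t : ℝ => x + t • w) (𝓝[>] 0) (𝓝 x) := by
    have hc : Continuous fun t : ℝ => x + t • w := by fun_prop
    simpa using (hc.tendsto 0).mono_left (nhdsWithin_le_nhds (s := Set.Ioi 0))
  obtain ⟨t, ht1, ht2⟩ := ((ht.eventually he).and self_mem_nhdsWithin).exists
  have ht0 : (0 : ℝ) < t := ht2
  rw [add_sub_cancel_left, map_smul, map_smul, hl, norm_smul, map_smul, smul_eq_mul,
    FunLike.coe_smul, Pi.smul_apply, hb, Real.norm_of_nonneg ht0.le, mul_pow] at ht1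
  have e : b / (4 * ‖w‖ ^ 2) * (t ^ 2 * ‖w‖ ^ 2) = b * t ^ 2 / 4 := by field_simp
  rw [e] at ht1
  have : 0 < b * t ^ 2 := by positivity
  simp only [smul_eq_mul, mul_zero] at ht1
  nlinarith

/-- A joint form of the lemmas of Alexandrov and Jensen: if every small linear perturbation of the
sum of two semiconvex functions attains its maximum, then at one of the maximum points both
functions are touched from above to second order by quadratic polynomials whose gradients
and second derivatives add up as required at a maximum. -/
theorem exists_second_order_maximum {n : ℕ} {K δ : ℝ} (hK : 0 ≤ K) (hδ : 0 < δ)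
    {f₁ f₂ : Euc n → ℝ} (hf₁ : SemiconvexWith K f₁) (hf₂ : SemiconvexWith K f₂)
    (hmax : ∀ p : Euc n, ‖p‖ < δ → ∃ x, ∀ y,
      f₁ y + f₂ y - inner ℝ p y ≤ f₁ x + f₂ x - inner ℝ p x) :
    ∃ (p x p₁ p₂ : Euc n) (B₁ B₂ : Euc n →L[ℝ] Euc n →L[ℝ] ℝ), ‖p‖ < δ ∧
      (∀ y, f₁ y + f₂ y - inner ℝ p y ≤ f₁ x + f₂ x - inner ℝ p x) ∧ p₁ + p₂ = p ∧
      (∀ v w, B₁ v w = B₁ w v) ∧ (∀ v w, B₂ v w = B₂ w v) ∧ (∀ w, B₁ w w + B₂ w w ≤ 0) ∧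
      (∀ ε > 0, ∀ᶠ y in 𝓝 x,
        f₁ y ≤ f₁ x + inner ℝ p₁ (y - x) + 2⁻¹ * B₁ (y - x) (y - x) + ε * ‖y - x‖ ^ 2) ∧
      (∀ ε > 0, ∀ᶠ y in 𝓝 x,
        f₂ y ≤ f₂ x + inner ℝ p₂ (y - x) + 2⁻¹ * B₂ (y - x) (y - x) + ε * ‖y - x‖ ^ 2) := by
  -- An arbitrary selection of maximum points: neither continuity nor measurability of `X` is
  -- needed, because the gradient map below is a left inverse of it.
  choose! X hX using hmax
  have haff : ∀ (p : Euc n) (c : ℝ) {f : Euc n → ℝ}, SemiconvexWith K f →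
      SemiconvexWith K fun x => -(c + inner ℝ p x - f x) := by
    intro p c f hf
    have := (semiconvexWith_affine (-c) (-p)).add hf
    rw [zero_add] at this
    convert this using 2 with x
    rw [inner_neg_left]
    ring
  obtain ⟨h₁, hh₁⟩ : ∃ h, h = upperEnvelope K f₁ := ⟨_, rfl⟩
  obtain ⟨h₂, hh₂⟩ : ∃ h, h = upperEnvelope K f₂ := ⟨_, rfl⟩
  let c : Euc n → ℝ := fun p => f₁ (X p) + f₂ (X p) - inner ℝ p (X p)
  have hfw₁ : ∀ p, ‖p‖ < δ → ∀ y, f₁ y ≤ c p + inner ℝ p y - f₂ y := by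
    intro p hp y
    have := hX p hp y
    simp only [c]
    linarith
  have h0 : ‖(0 : Euc n)‖ < δ := by simpa
  have hne₁ : ∃ q : ℝ × Euc n, ∀ y, f₁ y ≤ paraboloid K q y := by
    obtain ⟨q, hq, -⟩ := (haff 0 (c 0) hf₂).exists_paraboloid 0
    exact ⟨q, fun y => (hfw₁ 0 h0 y).trans (hq y)⟩
  have hle₁ : ∀ y, f₁ y ≤ h₁ y := by
    rw [hh₁]
    exact le_upperEnvelope hne₁
  have hsc₁ : SemiconvexWith K h₁ := by
    rw [hh₁]
    exact hf₁.upperEnvelope hne₁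
  have hsc₁' : SemiconvexWith K fun x => -h₁ x := by
    rw [hh₁]
    exact semiconvexWith_neg_upperEnvelope hne₁
  -- Minimality of the envelope: the majorant `c p + inner ℝ p y - f₂ y` of `f₁` is semiconcave, so
  -- it also dominates `h₁`. Thus `f₁` can be replaced by `h₁` without raising the maxima, and the
  -- same is then done with `f₂`.
  have hfw₂ : ∀ p, ‖p‖ < δ → ∀ y, f₂ y ≤ c p + inner ℝ p y - h₁ y := by
    intro p hp y
    have h3 : h₁ y ≤ c p + inner ℝ p y - f₂ y := by
      rw [hh₁]
      exact upperEnvelope_le (haff p (c p) hf₂) (hfw₁ p hp) y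
    linarith
  have hne₂ : ∃ q : ℝ × Euc n, ∀ y, f₂ y ≤ paraboloid K q y := by
    obtain ⟨q, hq, -⟩ := (haff 0 (c 0) hsc₁).exists_paraboloid 0
    exact ⟨q, fun y => (hfw₂ 0 h0 y).trans (hq y)⟩
  have hle₂ : ∀ y, f₂ y ≤ h₂ y := by
    rw [hh₂]
    exact le_upperEnvelope hne₂
  have hsc₂ : SemiconvexWith K h₂ := by
    rw [hh₂]
    exact hf₂.upperEnvelope hne₂
  have hsc₂' : SemiconvexWith K fun x => -h₂ x := by
    rw [hh₂]
    exact semiconvexWith_neg_upperEnvelope hne₂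
  have hsum : ∀ p, ‖p‖ < δ → ∀ y, h₁ y + h₂ y - inner ℝ p y ≤ c p := by
    intro p hp y
    have h3 : h₂ y ≤ c p + inner ℝ p y - h₁ y := by
      rw [hh₂]
      exact upperEnvelope_le (haff p (c p) hsc₁) (hfw₂ p hp) y
    linarith
  -- The envelopes dominate the functions, yet their tilted sum has the same maximum, so both
  -- inequalities are equalities at `X p`.
  have heq : ∀ p, ‖p‖ < δ → h₁ (X p) = f₁ (X p) ∧ h₂ (X p) = f₂ (X p) := by
    intro p hp
    have h3 := hsum p hp (X p)
    have h4 := hle₁ (X p)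
    have h5 := hle₂ (X p)
    simp only [c] at h3
    constructor <;> linarith
  obtain ⟨G₁, hG₁, hd₁⟩ := hsc₁.exists_lipschitz_gradient hK hsc₁'
  obtain ⟨G₂, hG₂, hd₂⟩ := hsc₂.exists_lipschitz_gradient hK hsc₂'
  have hgrad : ∀ p, ‖p‖ < δ → G₁ (X p) + G₂ (X p) = p := by
    intro p hp
    have hloc : IsLocalMax (fun y => h₁ y + h₂ y - inner ℝ p y) (X p) := by
      refine Eventually.of_forall fun y => ?_
      dsimp only
      rw [(heq p hp).1, (heq p hp).2]
      exact hsum p hp y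
    have hder := hloc.hasFDerivAt_eq_zero
      (((hd₁ (X p)).add (hd₂ (X p))).sub (innerSL ℝ p).hasFDerivAt)
    have h3 : innerSL ℝ (G₁ (X p) + G₂ (X p) - p) = 0 := by
      rw [map_sub, map_add]
      exact hder
    have h4 := congrArg (fun l => l (G₁ (X p) + G₂ (X p) - p)) h3
    simp only [innerSL_apply_apply, zero_apply, inner_self_eq_zero] at h4
    exact sub_eq_zero.1 h4
  obtain ⟨p, hp, hD₁, hD₂⟩ : ∃ p, ‖p‖ < δ ∧ DifferentiableAt ℝ G₁ (X p) ∧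
      DifferentiableAt ℝ G₂ (X p) := by
    by_contra! hcon
    let N : Set (Euc n) := {x | ¬ (DifferentiableAt ℝ G₁ x ∧ DifferentiableAt ℝ G₂ x)}
    have hN : volume N = 0 := by
      have := (hG₁.ae_differentiableAt (μ := volume)).and (hG₂.ae_differentiableAt (μ := volume))
      exact this
    have hsub : Metric.ball (0 : Euc n) δ ⊆ (fun x => G₁ x + G₂ x) '' N := by
      intro p hp
      have hp' : ‖p‖ < δ := by simpa using hp
      exact ⟨X p, fun h => hcon p hp' h.1 h.2, hgrad p hp'⟩
    have h3 := measure_mono_null hsub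
      (volume_image_eq_zero_of_lipschitzWith (hG₁.add hG₂) hN)
    exact (Metric.measure_ball_pos volume (0 : Euc n) hδ).ne' h3
  have hB : ∀ {G : Euc n → Euc n}, DifferentiableAt ℝ G (X p) →
      HasFDerivAt (fun x => innerSL ℝ (G x)) ((innerSL ℝ).comp (fderiv ℝ G (X p))) (X p) :=
    fun hD => (innerSL ℝ).hasFDerivAt.comp (X p) hD.hasFDerivAt
  have ht₁ := fun (ε : ℝ) (hε : 0 < ε) =>
    taylor_two_isLittleO (Eventually.of_forall hd₁) (hB hD₁) hε
  have ht₂ := fun (ε : ℝ) (hε : 0 < ε) =>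
    taylor_two_isLittleO (Eventually.of_forall hd₂) (hB hD₂) hε
  refine ⟨p, X p, G₁ (X p), G₂ (X p), (innerSL ℝ).comp (fderiv ℝ G₁ (X p)),
    (innerSL ℝ).comp (fderiv ℝ G₂ (X p)), hp, hX p hp, hgrad p hp,
    second_derivative_symmetric hd₁ (hB hD₁), second_derivative_symmetric hd₂ (hB hD₂), ?_, ?_, ?_⟩
  · intro w
    refine le_zero_of_eventually_quadratic (x := X p) (w := w) (l := 0)
      (B := (innerSL ℝ).comp (fderiv ℝ G₁ (X p)) + (innerSL ℝ).comp (fderiv ℝ G₂ (X p)))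
      (fun ε hε => ?_) rfl rfl
    filter_upwards [ht₁ (ε / 2) (by positivity), ht₂ (ε / 2) (by positivity)] with y hy₁ hy₂
    have h3 := hsum p hp y
    have h4 := (abs_le.1 hy₁).1
    have h5 := (abs_le.1 hy₂).1
    have h6 : inner ℝ (G₁ (X p)) (y - X p) + inner ℝ (G₂ (X p)) (y - X p) =
        inner ℝ p y - inner ℝ p (X p) := by
      rw [← inner_add_left, hgrad p hp, inner_sub_right]
    simp only [c, ← (heq p hp).1, ← (heq p hp).2] at h3
    rw [innerSL_apply_apply] at h4 h5
    simp only [zero_apply, add_apply]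
    linarith
  · intro ε hε
    filter_upwards [ht₁ ε hε] with y hy
    have h4 := (abs_le.1 hy).2
    rw [innerSL_apply_apply, (heq p hp).1] at h4
    linarith [hle₁ y]
  · intro ε hε
    filter_upwards [ht₂ ε hε] with y hy
    have h4 := (abs_le.1 hy).2
    rw [innerSL_apply_apply, (heq p hp).2] at h4
    linarith [hle₂ y]

end Semiconvex

/-! ### Sup-convolutions and quadratic polynomials. -/

section SupConvolution

variable {E : Type*} [NormedAddCommGroup E]

/-- The sup-convolution of the function whose hypograph is `H`. -/
noncomputable def supConv (H : Set (E × ℝ)) (k : ℝ) (x : E) : ℝ :=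
  ⨆ q : H, (q.1.2 - k / 2 * ‖x - q.1.1‖ ^ 2)

/-- `H` is a closed non-empty set whose projections to `E` and `ℝ` are bounded and bounded above. -/
structure IsBoundedHypograph (H : Set (E × ℝ)) (x₀ : E) (ρ M : ℝ) : Prop where
  isClosed : IsClosed H
  nonempty : H.Nonempty
  norm_le : ∀ q ∈ H, ‖q.1 - x₀‖ ≤ ρ
  le : ∀ q ∈ H, q.2 ≤ M

variable {H H₁ H₂ : Set (E × ℝ)} {x₀ : E} {ρ M k : ℝ}

theorem IsBoundedHypograph.le_supConv (h : IsBoundedHypograph H x₀ ρ M) (hk : 0 ≤ k) (x : E)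
    {q : E × ℝ} (hq : q ∈ H) : q.2 - k / 2 * ‖x - q.1‖ ^ 2 ≤ supConv H k x := by
  refine le_ciSup (f := fun q : H => q.1.2 - k / 2 * ‖x - q.1.1‖ ^ 2) ⟨M, ?_⟩ ⟨q, hq⟩
  rintro _ ⟨r, rfl⟩
  have h1 := h.le r r.2
  have h2 : 0 ≤ k / 2 * ‖x - r.1.1‖ ^ 2 := by positivity
  dsimp only
  linarith

/-- A quadratic polynomial touching the sup-convolution from above at `x` can be translated so
as to touch the original function at the point where the supremum is attained. -/
theorem IsBoundedHypograph.eventually_le_of_supConv (h : IsBoundedHypograph H x₀ ρ M) (hk : 0 ≤ k)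
    {x : E} {q : E × ℝ} (hx : supConv H k x = q.2 - k / 2 * ‖x - q.1‖ ^ 2) {g : E → ℝ}
    (hg : ∀ᶠ y in 𝓝 x, supConv H k y ≤ supConv H k x + g (y - x)) :
    ∀ᶠ y in 𝓝 q.1, ∀ t, (y, t) ∈ H → t ≤ q.2 + g (y - q.1) := by
  -- Evaluating the sup-convolution at `y + (x - q.1)` with competitor `y` gives the same penalty `k
  -- / 2 * ‖x - q.1‖ ^ 2` as at the contact point, so the penalties cancel.
  have ht : Tendsto (fun y => y + (x - q.1)) (𝓝 q.1) (𝓝 x) := by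
    have hc : Continuous fun y => y + (x - q.1) := by fun_prop
    simpa using hc.tendsto q.1
  filter_upwards [ht.eventually hg] with y hy t hyt
  have h1 := h.le_supConv hk (y + (x - q.1)) hyt
  have h2 : y + (x - q.1) - x = y - q.1 := by abel
  rw [h2, hx] at hy
  rw [add_sub_cancel_left] at h1
  linarith

variable [InnerProductSpace ℝ E]

/-- Heights in `H` need not be bounded below, but competitors at least as good as a fixed `q₀` have
height at least its penalised value, and these form a compact set. -/
theorem IsBoundedHypograph.exists_isMax [FiniteDimensional ℝ E]
    (h : IsBoundedHypograph H x₀ ρ M) (hk : 0 ≤ k) (x : E) :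
    ∃ q ∈ H, ∀ r ∈ H, r.2 - k / 2 * ‖x - r.1‖ ^ 2 ≤ q.2 - k / 2 * ‖x - q.1‖ ^ 2 := by
  obtain ⟨q₀, hq₀⟩ := h.nonempty
  let f : E × ℝ → ℝ := fun q => q.2 - k / 2 * ‖x - q.1‖ ^ 2
  have hf : Continuous f := by fun_prop
  have hcomp : IsCompact (H ∩ {q | f q₀ ≤ f q}) := by
    refine ((isCompact_closedBall x₀ ρ).prod (isCompact_Icc (a := f q₀) (b := M))).of_isClosed_subset
      (h.isClosed.inter (isClosed_le continuous_const hf)) ?_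
    rintro q ⟨hq, hq'⟩
    refine ⟨by simpa [dist_eq_norm] using h.norm_le q hq, ?_, h.le q hq⟩
    have h1 : f q₀ ≤ f q := hq'
    have h2 : 0 ≤ k / 2 * ‖x - q.1‖ ^ 2 := by positivity
    simp only [f] at h1 ⊢
    linarith
  obtain ⟨q, hq, hmax⟩ := hcomp.exists_isMaxOn ⟨q₀, hq₀, le_refl (f q₀)⟩ hf.continuousOn
  refine ⟨q, hq.1, fun r hr => ?_⟩
  rcases le_total (f q₀) (f r) with h1 | h1
  · exact hmax ⟨hr, h1⟩
  · exact h1.trans hq.2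

theorem IsBoundedHypograph.exists_supConv_eq [FiniteDimensional ℝ E]
    (h : IsBoundedHypograph H x₀ ρ M) (hk : 0 ≤ k) (x : E) :
    ∃ q ∈ H, supConv H k x = q.2 - k / 2 * ‖x - q.1‖ ^ 2 := by
  obtain ⟨q, hq, hmax⟩ := h.exists_isMax hk x
  have : Nonempty H := ⟨⟨q, hq⟩⟩
  refine ⟨q, hq, le_antisymm (ciSup_le fun r => hmax r r.2) ?_⟩
  exact le_ciSup (f := fun q : H => q.1.2 - k / 2 * ‖x - q.1.1‖ ^ 2)
    ⟨_, by rintro _ ⟨r, rfl⟩; exact hmax r r.2⟩ ⟨q, hq⟩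

/-- A maximiser at the intermediate point is a competitor at both endpoints, and `-k / 2 * ‖x - q.1‖
^ 2` has convexity defect exactly `k`. -/
theorem IsBoundedHypograph.semiconvexWith_supConv [FiniteDimensional ℝ E]
    (h : IsBoundedHypograph H x₀ ρ M) (hk : 0 ≤ k) : SemiconvexWith k (supConv H k) := by
  intro a b s t hs ht hst
  obtain ⟨q, hq, hx⟩ := h.exists_supConv_eq hk (s • a + t • b)
  have h1 := mul_le_mul_of_nonneg_left (h.le_supConv hk a hq) hs
  have h2 := mul_le_mul_of_nonneg_left (h.le_supConv hk b hq) ht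
  have h3 : s • a + t • b - q.1 = s • (a - q.1) + t • (b - q.1) := by
    rw [smul_sub, smul_sub, sub_add_sub_comm, ← add_smul, hst, one_smul]
  rw [hx, h3, norm_sq_convex_combination _ _ hst, sub_sub_sub_cancel_right]
  obtain rfl : t = 1 - s := by linarith
  linarith

/-- The quadratic polynomial with given value, gradient and second derivative at `x₀`. -/
noncomputable def quadratic (c : ℝ) (b : E) (B : E →L[ℝ] E →L[ℝ] ℝ) (x₀ x : E) : ℝ :=
  c + inner ℝ b (x - x₀) + 2⁻¹ * B (x - x₀) (x - x₀)

theorem continuous_quadratic (c : ℝ) (b : E) (B : E →L[ℝ] E →L[ℝ] ℝ) (x₀ : E) :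
    Continuous (quadratic c b B x₀) := by
  unfold quadratic
  fun_prop

theorem semiconvexWith_neg_quadratic (c : ℝ) (b : E) (B : E →L[ℝ] E →L[ℝ] ℝ) (x₀ : E) :
    SemiconvexWith ‖B‖ fun x => -quadratic c b B x₀ x := by
  intro x y s t hs ht hst
  have h3 : s • x + t • y - x₀ = s • (x - x₀) + t • (y - x₀) := by
    rw [smul_sub, smul_sub, sub_add_sub_comm, ← add_smul, hst, one_smul]
  have h4 : B (x - y) (x - y) ≤ ‖B‖ * ‖x - y‖ * ‖x - y‖ :=
    (le_abs_self _).trans (B.le_opNorm₂ _ _)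
  have h5 : x - y = (x - x₀) - (y - x₀) := by abel
  rw [h5] at h4 ⊢
  simp only [quadratic, h3]
  generalize x - x₀ = x at *
  generalize y - x₀ = y at *
  have h6 := mul_le_mul_of_nonneg_left h4 (mul_nonneg hs ht)
  simp only [map_add, map_smul, map_sub, add_apply, sub_apply,
    FunLike.coe_smul, Pi.smul_apply, smul_eq_mul, inner_add_right, real_inner_smul_right] at h6 ⊢
  obtain rfl : t = 1 - s := by linarith
  nlinarith

theorem quadratic_eq_recentered [CompleteSpace E] (c : ℝ) (b : E) {B : E →L[ℝ] E →L[ℝ] ℝ}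
    (hB : ∀ v w, B v w = B w v) (x₀ x y : E) :
    quadratic c b B x₀ y = quadratic c b B x₀ x +
      inner ℝ (b + (InnerProductSpace.toDual ℝ E).symm (B (x - x₀))) (y - x) +
      2⁻¹ * B (y - x) (y - x) := by
  have h1 : y - x₀ = (x - x₀) + (y - x) := by abel
  simp only [quadratic, h1, inner_add_left, InnerProductSpace.toDual_symm_apply]
  simp only [inner_add_right, map_add, add_apply, hB (y - x) (x - x₀)]
  ring

theorem exists_neg_le_quadratic (c : ℝ) (b : E) (B : E →L[ℝ] E →L[ℝ] ℝ) (x₀ : E) :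
    ∃ Λ : ℝ, 0 ≤ Λ ∧ ∀ x, -(Λ * (1 + ‖x - x₀‖ ^ 2)) ≤ quadratic c b B x₀ x := by
  refine ⟨|c| + ‖b‖ + ‖B‖, by positivity, fun x => ?_⟩
  have h1 := neg_abs_le c
  have h2 := (abs_le.1 (abs_real_inner_le_norm b (x - x₀))).1
  have h3 := (abs_le.1 (B.le_opNorm₂ (x - x₀) (x - x₀))).1
  simp only [quadratic]
  have h4 := norm_nonneg (x - x₀)
  have h5 := norm_nonneg b
  have h6 := norm_nonneg B
  have h7 := abs_nonneg c
  have h8 : ‖b‖ * ‖x - x₀‖ ≤ ‖b‖ * (1 + ‖x - x₀‖ ^ 2) := by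
    gcongr
    nlinarith
  nlinarith [mul_nonneg h7 (sq_nonneg ‖x - x₀‖), mul_nonneg h6 (sq_nonneg ‖x - x₀‖)]

end SupConvolution

/-! ### The theorem on sums. -/

section Sums

variable {n : ℕ} {H₁ H₂ : Set (Euc n × ℝ)} {x₀ : Euc n} {ρ M : ℝ}

/-- The quantity maximised when the variables of a sum are doubled. -/
noncomputable def penalizedSum (Q : Euc n → ℝ) (k : ℝ) (p x₀ x : Euc n) (q₁ q₂ : Euc n × ℝ) : ℝ :=
  q₁.2 - k / 2 * ‖x - q₁.1‖ ^ 2 + (q₂.2 - k / 2 * ‖x - q₂.1‖ ^ 2) - Q x - inner ℝ p (x - x₀)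

theorem neg_le_add_inner {Q : Euc n → ℝ} {Λ : ℝ}
    (hQ : ∀ x, -(Λ * (1 + ‖x - x₀‖ ^ 2)) ≤ Q x) {p : Euc n} (hp : ‖p‖ ≤ 1) (x : Euc n) :
    -((Λ + 1) * (1 + ‖x - x₀‖ ^ 2)) ≤ Q x + inner ℝ p (x - x₀) := by
  have h1 := hQ x
  have h2 := (abs_le.1 (abs_real_inner_le_norm p (x - x₀))).1
  have h3 : ‖p‖ * ‖x - x₀‖ ≤ 1 * ‖x - x₀‖ := by gcongr
  nlinarith [sq_nonneg (‖x - x₀‖ - 1)]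

/-- For a large penalisation, the points are close to each other wherever the penalised sum is
nonnegative. -/
theorem exists_penalization_forall_close (h₁ : IsBoundedHypograph H₁ x₀ ρ M)
    (h₂ : IsBoundedHypograph H₂ x₀ ρ M) {Q : Euc n → ℝ} {Λ : ℝ} (hΛ : 0 ≤ Λ)
    (hQ : ∀ x, -(Λ * (1 + ‖x - x₀‖ ^ 2)) ≤ Q x) {τ : ℝ} (hτ : 0 < τ) :
    ∃ k : ℝ, 0 < k ∧ ∀ p : Euc n, ‖p‖ ≤ 1 → ∀ x, ∀ q₁ ∈ H₁, ∀ q₂ ∈ H₂,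
      0 ≤ penalizedSum Q k p x₀ x q₁ q₂ → ‖x - q₁.1‖ < τ ∧ ‖x - q₂.1‖ < τ := by
  obtain ⟨C, hC⟩ : ∃ C, C = |2 * M + (Λ + 1) * (1 + 2 * ρ ^ 2)| := ⟨_, rfl⟩
  have hC0 : 0 ≤ C := hC ▸ abs_nonneg _
  obtain ⟨T, hT⟩ : ∃ T, T = (C + 1) / τ ^ 2 := ⟨_, rfl⟩
  have hT0 : 0 < T := by rw [hT]; positivity
  -- In `k / 2`, the part `2 * (Λ + 1)` absorbs the quadratic growth of `-Q` and of the tilt, and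
  -- `T` forces the distances below `τ`.
  refine ⟨2 * (2 * (Λ + 1) + T), by positivity, fun p hp x q₁ hq₁ q₂ hq₂ h => ?_⟩
  have e1 := neg_le_add_inner hQ hp x
  have e2 : ‖x - x₀‖ ≤ ‖x - q₁.1‖ + ρ := by
    calc ‖x - x₀‖ = ‖(x - q₁.1) + (q₁.1 - x₀)‖ := by rw [sub_add_sub_cancel]
      _ ≤ ‖x - q₁.1‖ + ‖q₁.1 - x₀‖ := norm_add_le _ _
      _ ≤ _ := by gcongr; exact h₁.norm_le q₁ hq₁
  have e3 : ‖x - x₀‖ ^ 2 ≤ 2 * ‖x - q₁.1‖ ^ 2 + 2 * ρ ^ 2 := by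
    have : ‖x - x₀‖ ^ 2 ≤ (‖x - q₁.1‖ + ρ) ^ 2 := by gcongr
    nlinarith [sq_nonneg (‖x - q₁.1‖ - ρ)]
  have e4 : (Λ + 1) * (1 + ‖x - x₀‖ ^ 2) ≤
      (Λ + 1) * (1 + (2 * ‖x - q₁.1‖ ^ 2 + 2 * ρ ^ 2)) := by gcongr
  have e5 := h₁.le q₁ hq₁
  have e6 := h₂.le q₂ hq₂
  have e7 := le_abs_self (2 * M + (Λ + 1) * (1 + 2 * ρ ^ 2))
  rw [← hC] at e7
  have e8 : 0 ≤ (Λ + 1) * ‖x - q₂.1‖ ^ 2 := by positivity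
  have e9 : T * (‖x - q₁.1‖ ^ 2 + ‖x - q₂.1‖ ^ 2) ≤ C := by
    simp only [penalizedSum] at h
    linarith
  have e10 : ‖x - q₁.1‖ ^ 2 + ‖x - q₂.1‖ ^ 2 < τ ^ 2 := by
    have h3 : C < T * τ ^ 2 := by
      rw [hT, div_mul_cancel₀ _ (by positivity)]
      linarith
    exact lt_of_mul_lt_mul_left (e9.trans_lt h3) hT0.le
  constructor
  · exact lt_of_pow_lt_pow_left₀ 2 hτ.le (by nlinarith [sq_nonneg ‖x - q₂.1‖])
  · exact lt_of_pow_lt_pow_left₀ 2 hτ.le (by nlinarith [sq_nonneg ‖x - q₁.1‖])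

/-- If the sum is at most `Q`, with equality only at `x₀`, then pairs of nearby points where it is
almost at least `Q` are close to `x₀`. -/
theorem exists_forall_close_of_nearly_touching (h₁ : IsBoundedHypograph H₁ x₀ ρ M)
    (h₂ : IsBoundedHypograph H₂ x₀ ρ M) {Q : Euc n → ℝ} (hQc : Continuous Q) {Λ : ℝ} (hΛ : 0 ≤ Λ)
    (hQ : ∀ x, -(Λ * (1 + ‖x - x₀‖ ^ 2)) ≤ Q x)
    (hlt : ∀ q₁ ∈ H₁, ∀ q₂ ∈ H₂, q₁.1 = q₂.1 → q₁.1 ≠ x₀ → q₁.2 + q₂.2 < Q q₁.1)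
    {r : ℝ} (hr : 0 < r) :
    ∃ τ : ℝ, 0 < τ ∧ ∀ p : Euc n, ‖p‖ < τ → ∀ x, ∀ q₁ ∈ H₁, ∀ q₂ ∈ H₂,
      0 ≤ q₁.2 + q₂.2 - Q x - inner ℝ p (x - x₀) → ‖x - q₁.1‖ < τ → ‖x - q₂.1‖ < τ →
        ‖q₁.1 - x₀‖ < r := by
  -- A lower bound for each height, forced by the nonnegativity condition and the upper bound `M` on
  -- the other one; it makes the set `S` of far configurations compact.
  obtain ⟨m, hm⟩ : ∃ m, m = -((Λ + 1) * (1 + (ρ + 1) ^ 2)) - M := ⟨_, rfl⟩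
  let S : Set ((Euc n × Euc n) × ((Euc n × ℝ) × (Euc n × ℝ))) :=
    {s | s.2.1 ∈ H₁ ∧ s.2.2 ∈ H₂ ∧ ‖s.1.1‖ ≤ 1 ∧ ‖s.1.2 - s.2.1.1‖ ≤ 1 ∧
      0 ≤ s.2.1.2 + s.2.2.2 - Q s.1.2 - inner ℝ s.1.1 (s.1.2 - x₀) ∧ r ≤ ‖s.2.1.1 - x₀‖}
  have hS : IsCompact S := by
    have hbox := ((isCompact_closedBall (0 : Euc n) 1).prod (isCompact_closedBall x₀ (ρ + 1))).prod
      (((isCompact_closedBall x₀ ρ).prod (isCompact_Icc (a := m) (b := M))).prod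
        ((isCompact_closedBall x₀ ρ).prod (isCompact_Icc (a := m) (b := M))))
    refine hbox.of_isClosed_subset ?_ ?_
    · have c₁ : IsClosed {s : (Euc n × Euc n) × ((Euc n × ℝ) × (Euc n × ℝ)) | s.2.1 ∈ H₁} :=
        h₁.isClosed.preimage (by fun_prop)
      have c₂ : IsClosed {s : (Euc n × Euc n) × ((Euc n × ℝ) × (Euc n × ℝ)) | s.2.2 ∈ H₂} :=
        h₂.isClosed.preimage (by fun_prop)
      simp only [S, Set.ofPred_and]
      refine c₁.inter (c₂.inter (IsClosed.inter ?_ (IsClosed.inter ?_ (IsClosed.inter ?_ ?_)))) <;>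
        exact isClosed_le (by fun_prop) (by fun_prop)
    · rintro ⟨⟨p, x⟩, ⟨q₁, q₂⟩⟩ ⟨hq₁, hq₂, hp, hx, hpos, -⟩
      dsimp only at hq₁ hq₂ hp hx hpos
      have e0 : ‖x - x₀‖ ≤ ρ + 1 := by
        calc ‖x - x₀‖ = ‖(x - q₁.1) + (q₁.1 - x₀)‖ := by rw [sub_add_sub_cancel]
          _ ≤ ‖x - q₁.1‖ + ‖q₁.1 - x₀‖ := norm_add_le _ _
          _ ≤ ρ + 1 := by linarith [h₁.norm_le q₁ hq₁]
      have e1 := neg_le_add_inner hQ hp x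
      have e2 : (Λ + 1) * (1 + ‖x - x₀‖ ^ 2) ≤ (Λ + 1) * (1 + (ρ + 1) ^ 2) := by gcongr
      have e3 := h₁.le q₁ hq₁
      have e4 := h₂.le q₂ hq₂
      refine ⟨⟨by simpa using hp, by simpa [dist_eq_norm] using e0⟩, ⟨?_, ?_, e3⟩, ⟨?_, ?_, e4⟩⟩
      · simpa [dist_eq_norm] using h₁.norm_le q₁ hq₁
      · change m ≤ q₁.2
        linarith
      · simpa [dist_eq_norm] using h₂.norm_le q₂ hq₂
      · change m ≤ q₂.2
        linarith
  let g : (Euc n × Euc n) × ((Euc n × ℝ) × (Euc n × ℝ)) → ℝ := fun s =>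
    ‖s.1.1‖ + ‖s.1.2 - s.2.1.1‖ + ‖s.1.2 - s.2.2.1‖
  have hg : Continuous g := by fun_prop
  -- Where `g` vanishes there is no tilt and the three points coincide, contradicting strict
  -- touching away from `x₀`. Compactness then bounds `g` below on `S`.
  have hgpos : ∀ s ∈ S, 0 < g s := by
    rintro ⟨⟨p, x⟩, ⟨q₁, q₂⟩⟩ ⟨hq₁, hq₂, -, -, hpos, hfar⟩
    dsimp only at hq₁ hq₂ hpos hfar
    by_contra! hle
    have n1 := norm_nonneg p
    have n2 := norm_nonneg (x - q₁.1)
    have n3 := norm_nonneg (x - q₂.1)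
    simp only [g] at hle
    have z1 : p = 0 := norm_eq_zero.1 (by linarith)
    have z2 : x = q₁.1 := sub_eq_zero.1 (norm_eq_zero.1 (by linarith))
    have z3 : x = q₂.1 := sub_eq_zero.1 (norm_eq_zero.1 (by linarith))
    have hne : q₁.1 ≠ x₀ := by
      rintro h
      rw [h, sub_self, norm_zero] at hfar
      linarith
    have := hlt q₁ hq₁ q₂ hq₂ (z2.symm.trans z3) hne
    rw [z1, inner_zero_left, z2] at hpos
    linarith
  obtain ⟨σ, hσ, hσg⟩ := hS.exists_forall_le' hg.continuousOn hgpos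
  refine ⟨min 1 (σ / 3), by positivity, fun p hp x q₁ hq₁ q₂ hq₂ hpos hx₁ hx₂ => ?_⟩
  by_contra! hfar
  have b1 := min_le_left 1 (σ / 3)
  have b2 := min_le_right 1 (σ / 3)
  have := hσg ((p, x), (q₁, q₂)) ⟨hq₁, hq₂, by dsimp only; linarith, by dsimp only; linarith,
    hpos, hfar⟩
  simp only [g] at this
  linarith

/-- The order of choices matters: the closeness `τ` depends only on `r`, and `k` is then taken large
enough to enforce it. -/
theorem exists_penalization_forall_near (h₁ : IsBoundedHypograph H₁ x₀ ρ M)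
    (h₂ : IsBoundedHypograph H₂ x₀ ρ M) {Q : Euc n → ℝ} (hQc : Continuous Q) {Λ : ℝ} (hΛ : 0 ≤ Λ)
    (hQ : ∀ x, -(Λ * (1 + ‖x - x₀‖ ^ 2)) ≤ Q x)
    (hlt : ∀ q₁ ∈ H₁, ∀ q₂ ∈ H₂, q₁.1 = q₂.1 → q₁.1 ≠ x₀ → q₁.2 + q₂.2 < Q q₁.1)
    {r : ℝ} (hr : 0 < r) :
    ∃ k δ : ℝ, 0 < k ∧ 0 < δ ∧ ∀ p : Euc n, ‖p‖ < δ → ∀ x, ∀ q₁ ∈ H₁, ∀ q₂ ∈ H₂,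
      0 ≤ penalizedSum Q k p x₀ x q₁ q₂ → ‖x - x₀‖ < r ∧ ‖q₁.1 - x₀‖ < r ∧ ‖q₂.1 - x₀‖ < r := by
  obtain ⟨τ, hτ, hnear⟩ := exists_forall_close_of_nearly_touching h₁ h₂ hQc hΛ hQ hlt
    (r := r / 3) (by positivity)
  obtain ⟨k, hk, hclose⟩ := exists_penalization_forall_close h₁ h₂ hΛ hQ
    (τ := min τ (r / 3)) (by positivity)
  refine ⟨k, min τ 1, hk, by positivity, fun p hp x q₁ hq₁ q₂ hq₂ hpos => ?_⟩
  obtain ⟨hp₁, hp₂⟩ := lt_min_iff.1 hp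
  obtain ⟨c₁, c₂⟩ := hclose p hp₂.le x q₁ hq₁ q₂ hq₂ hpos
  rw [lt_min_iff] at c₁ c₂
  have s1 : 0 ≤ k / 2 * ‖x - q₁.1‖ ^ 2 := by positivity
  have s2 : 0 ≤ k / 2 * ‖x - q₂.1‖ ^ 2 := by positivity
  have h3 := hnear p hp₁ x q₁ hq₁ q₂ hq₂ (by simp only [penalizedSum] at hpos; linarith) c₁.1 c₂.1
  have h4 : ‖x - x₀‖ < 2 * (r / 3) := by
    calc ‖x - x₀‖ = ‖(x - q₁.1) + (q₁.1 - x₀)‖ := by rw [sub_add_sub_cancel]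
      _ ≤ ‖x - q₁.1‖ + ‖q₁.1 - x₀‖ := norm_add_le _ _
      _ < _ := by linarith
  have h5 : ‖q₂.1 - x₀‖ < r := by
    calc ‖q₂.1 - x₀‖ = ‖(x - x₀) - (x - q₂.1)‖ := by rw [sub_sub_sub_cancel_left]
      _ ≤ ‖x - x₀‖ + ‖x - q₂.1‖ := norm_sub_le _ _
      _ < r := by linarith
  exact ⟨by linarith, by linarith, h5⟩

/-- The theorem on sums: if the sum of two upper semicontinuous functions, given by their
hypographs, is strictly touched from above at `x₀` by a quadratic polynomial, then the two
functions have upper contact quadratics at points near `x₀` which add up accordingly. -/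
theorem exists_contact_of_sum (h₁ : IsBoundedHypograph H₁ x₀ ρ M)
    (h₂ : IsBoundedHypograph H₂ x₀ ρ M) {c : ℝ} {b : Euc n} {B : Euc n →L[ℝ] Euc n →L[ℝ] ℝ}
    (hB : ∀ v w, B v w = B w v) {t₁ t₂ : ℝ} (ht₁ : (x₀, t₁) ∈ H₁) (ht₂ : (x₀, t₂) ∈ H₂)
    (ht : t₁ + t₂ = c)
    (hlt : ∀ q₁ ∈ H₁, ∀ q₂ ∈ H₂, q₁.1 = q₂.1 → q₁.1 ≠ x₀ →
      q₁.2 + q₂.2 < quadratic c b B x₀ q₁.1) {r : ℝ} (hr : 0 < r) :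
    ∃ (x p p₁ p₂ : Euc n) (B₁ B₂ : Euc n →L[ℝ] Euc n →L[ℝ] ℝ) (q₁ q₂ : Euc n × ℝ),
      ‖x - x₀‖ < r ∧ ‖p‖ < r ∧ ‖q₁.1 - x₀‖ < r ∧ ‖q₂.1 - x₀‖ < r ∧ q₁ ∈ H₁ ∧ q₂ ∈ H₂ ∧
      quadratic c b B x₀ x + inner ℝ p (x - x₀) ≤ q₁.2 + q₂.2 ∧
      p₁ + p₂ = p + (b + (InnerProductSpace.toDual ℝ (Euc n)).symm (B (x - x₀))) ∧
      (∀ v w, B₁ v w = B₁ w v) ∧ (∀ v w, B₂ v w = B₂ w v) ∧ (∀ w, B₁ w w + B₂ w w ≤ B w w) ∧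
      (∀ ε > 0, ∀ᶠ y in 𝓝 q₁.1, ∀ t, (y, t) ∈ H₁ → t ≤ q₁.2 +
        (inner ℝ p₁ (y - q₁.1) + 2⁻¹ * B₁ (y - q₁.1) (y - q₁.1) + ε * ‖y - q₁.1‖ ^ 2)) ∧
      (∀ ε > 0, ∀ᶠ y in 𝓝 q₂.1, ∀ t, (y, t) ∈ H₂ → t ≤ q₂.2 +
        (inner ℝ p₂ (y - q₂.1) + 2⁻¹ * B₂ (y - q₂.1) (y - q₂.1) + ε * ‖y - q₂.1‖ ^ 2)) := by
  obtain ⟨Q, hQ⟩ : ∃ Q, Q = quadratic c b B x₀ := ⟨_, rfl⟩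
  have hQc : Continuous Q := hQ ▸ continuous_quadratic c b B x₀
  obtain ⟨Λ, hΛ, hQΛ⟩ := exists_neg_le_quadratic c b B x₀
  rw [← hQ] at hlt hQΛ
  obtain ⟨k, δ, hk, hδ, hnear⟩ := exists_penalization_forall_near h₁ h₂ hQc hΛ hQΛ hlt hr
  obtain ⟨U, hU⟩ : ∃ U, U = supConv H₁ k := ⟨_, rfl⟩
  obtain ⟨V, hV⟩ : ∃ V, V = supConv H₂ k := ⟨_, rfl⟩
  have hUsc : SemiconvexWith k U := hU ▸ h₁.semiconvexWith_supConv hk.le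
  have hVsc : SemiconvexWith k V := hV ▸ h₂.semiconvexWith_supConv hk.le
  have hQsc : SemiconvexWith ‖B‖ fun x => -Q x := hQ ▸ semiconvexWith_neg_quadratic c b B x₀
  have hf₁ : SemiconvexWith (k + ‖B‖) U := hUsc.mono (by linarith [norm_nonneg B])
  have hf₂ : SemiconvexWith (k + ‖B‖) fun x => V x + -Q x := hVsc.add hQsc
  have hzero : ∀ p : Euc n, 0 ≤ U x₀ + V x₀ - Q x₀ - inner ℝ p (x₀ - x₀) := by
    intro p
    have e1 := h₁.le_supConv hk.le x₀ ht₁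
    have e2 := h₂.le_supConv hk.le x₀ ht₂
    have e3 : Q x₀ = c := by rw [hQ]; simp [quadratic]
    rw [← hU] at e1
    rw [← hV] at e2
    simp only [sub_self, norm_zero, inner_zero_right] at e1 e2 ⊢
    linarith
  have hcontact : ∀ p : Euc n, ‖p‖ < δ → ∀ x, 0 ≤ U x + V x - Q x - inner ℝ p (x - x₀) →
      ∃ q₁ ∈ H₁, ∃ q₂ ∈ H₂, U x = q₁.2 - k / 2 * ‖x - q₁.1‖ ^ 2 ∧
        V x = q₂.2 - k / 2 * ‖x - q₂.1‖ ^ 2 ∧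
        ‖x - x₀‖ < r ∧ ‖q₁.1 - x₀‖ < r ∧ ‖q₂.1 - x₀‖ < r := by
    intro p hp x hx
    obtain ⟨q₁, hq₁, e1⟩ := h₁.exists_supConv_eq hk.le x
    obtain ⟨q₂, hq₂, e2⟩ := h₂.exists_supConv_eq hk.le x
    rw [← hU] at e1
    rw [← hV] at e2
    refine ⟨q₁, hq₁, q₂, hq₂, e1, e2, hnear p hp x q₁ hq₁ q₂ hq₂ ?_⟩
    rw [penalizedSum, ← e1, ← e2]
    exact hx
  obtain ⟨p, x, p₁, p₂, B₁, B₂, hp, hmax, hp₁₂, hs₁, hs₂, hle, hT₁, hT₂⟩ :=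
    exists_second_order_maximum (δ := min δ r) (by positivity) (by positivity) hf₁ hf₂ (by
      intro p hp
      have hp' := (lt_min_iff.1 hp).1
      have hcont : Continuous fun x => U x + V x - Q x - inner ℝ p (x - x₀) := by
        have := hUsc.continuous
        have := hVsc.continuous
        fun_prop
      -- The maximum over this ball is global: the tilted function is nonnegative at `x₀`, and can
      -- be nonnegative only within `r` of `x₀`.
      obtain ⟨x, -, hx⟩ := (isCompact_closedBall x₀ r).exists_isMaxOn
        ⟨x₀, Metric.mem_closedBall_self hr.le⟩ hcont.continuousOn
      have hx₀ := hx (Metric.mem_closedBall_self hr.le)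
      refine ⟨x, fun y => ?_⟩
      have hy : U y + V y - Q y - inner ℝ p (y - x₀) ≤ U x + V x - Q x - inner ℝ p (x - x₀) := by
        rcases le_total 0 (U y + V y - Q y - inner ℝ p (y - x₀)) with h | h
        · obtain ⟨_, _, _, _, _, _, hyr, _⟩ := hcontact p hp' y h
          exact hx (by simpa [dist_eq_norm] using hyr.le)
        · exact h.trans ((hzero p).trans hx₀)
      simp only [inner_sub_right] at hy
      linarith)
  obtain ⟨hpδ, hpr⟩ := lt_min_iff.1 hp
  have hx : 0 ≤ U x + V x - Q x - inner ℝ p (x - x₀) := by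
    refine (hzero p).trans ?_
    have := hmax x₀
    simp only [inner_sub_right]
    linarith
  obtain ⟨q₁, hq₁, q₂, hq₂, e1, e2, r1, r2, r3⟩ := hcontact p hpδ x hx
  have hrec : ∀ y, Q y = Q x +
      inner ℝ (b + (InnerProductSpace.toDual ℝ (Euc n)).symm (B (x - x₀))) (y - x) +
      2⁻¹ * B (y - x) (y - x) := by
    rw [hQ]
    exact quadratic_eq_recentered c b hB x₀ x
  rw [← hQ]
  -- The second semiconvex function was `V - Q`; adding back the gradient of `Q` at `x` and its
  -- Hessian `B` gives the contact data of `V`.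
  refine ⟨x, p, p₁, p₂ + (b + (InnerProductSpace.toDual ℝ (Euc n)).symm (B (x - x₀))), B₁,
    B₂ + B, q₁, q₂, r1, hpr, r2, r3, hq₁, hq₂, ?_, ?_, hs₁, ?_, ?_, ?_, ?_⟩
  · have s1 : 0 ≤ k / 2 * ‖x - q₁.1‖ ^ 2 := by positivity
    have s2 : 0 ≤ k / 2 * ‖x - q₂.1‖ ^ 2 := by positivity
    linarith
  · rw [← hp₁₂, add_assoc]
  · intro v w
    rw [add_apply, add_apply, add_apply, add_apply, hs₂ v w, hB v w]
  · intro w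
    rw [add_apply, add_apply]
    linarith [hle w]
  · intro ε hε
    rw [hU] at e1
    refine h₁.eventually_le_of_supConv hk.le e1
      (g := fun z => inner ℝ p₁ z + 2⁻¹ * B₁ z z + ε * ‖z‖ ^ 2) ?_
    filter_upwards [hT₁ ε hε] with y hy
    rw [hU] at hy
    linarith
  · intro ε hε
    rw [hV] at e2
    refine h₂.eventually_le_of_supConv hk.le e2 (g := fun z =>
      inner ℝ (p₂ + (b + (InnerProductSpace.toDual ℝ (Euc n)).symm (B (x - x₀)))) z +
        2⁻¹ * (B₂ + B) z z + ε * ‖z‖ ^ 2) ?_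
    filter_upwards [hT₂ ε hε] with y hy
    rw [hrec y, hV] at hy
    simp only [add_apply, inner_add_left] at hy ⊢
    linarith

end Sums

/-! ### Jets of quadratic polynomials. -/

section Jets

variable {n : ℕ}

/-- The inner product as a bilinear form. -/
noncomputable def innerForm (n : ℕ) : Euc n →L[ℝ] Euc n →L[ℝ] ℝ := innerSL ℝ

theorem innerForm_apply (x y : Euc n) : innerForm n x y = inner ℝ x y := rfl

/-- The symmetric matrix of the symmetric part of a bilinear form. -/
noncomputable def bilinMatrix : (Euc n →L[ℝ] Euc n →L[ℝ] ℝ) →ₗ[ℝ] symMatrix n where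
  toFun B :=
    let A : Matrix (Fin n) (Fin n) ℝ := Matrix.of fun i j =>
      B (EuclideanSpace.single i 1) (EuclideanSpace.single j 1)
    ⟨(2⁻¹ : ℝ) • (A + A.transpose), by
      show Matrix.IsSymm _
      simp [Matrix.IsSymm, add_comm]⟩
  map_add' B C := by
    ext i j
    simp
    ring
  map_smul' c B := by
    ext i j
    simp
    ring

theorem bilinMatrix_sub (B C : Euc n →L[ℝ] Euc n →L[ℝ] ℝ) :
    bilinMatrix (B - C) = bilinMatrix B - bilinMatrix C := by
  ext i j
  simp [bilinMatrix]
  ring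

theorem hessian_eq_bilinMatrix (φ : Euc n → ℝ) (x : Euc n) :
    hessian φ x = bilinMatrix (fderiv ℝ (fderiv ℝ φ) x) := rfl

/-- Symmetrising a bilinear form does not change its quadratic form. -/
theorem posSemidef_bilinMatrix {B : Euc n →L[ℝ] Euc n →L[ℝ] ℝ} (hB : ∀ w, 0 ≤ B w w) :
    (bilinMatrix B : Matrix (Fin n) (Fin n) ℝ).PosSemidef := by
  refine Matrix.PosSemidef.of_dotProduct_mulVec_nonneg ?_ fun x => ?_
  · have h : (bilinMatrix B : Matrix (Fin n) (Fin n) ℝ).IsSymm := (bilinMatrix B).2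
    rw [Matrix.IsHermitian, Matrix.conjTranspose_eq_transpose_of_trivial]
    exact h
  · have hw : WithLp.toLp 2 x = ∑ i, x i • EuclideanSpace.single i (1 : ℝ) := by
      ext j
      simp [Finset.sum_apply, Pi.single_apply]
    have h := hB (WithLp.toLp 2 x)
    have e : B (WithLp.toLp 2 x) (WithLp.toLp 2 x) = ∑ i, ∑ j, x i * x j *
        B (EuclideanSpace.single i 1) (EuclideanSpace.single j 1) := by
      rw [hw]
      simp only [map_sum, map_smul, sum_apply, FunLike.coe_smul, Pi.smul_apply,
        smul_eq_mul, Finset.mul_sum]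
      rw [Finset.sum_comm]
      exact Finset.sum_congr rfl fun i _ => Finset.sum_congr rfl fun j _ => by ring
    have e' : ∑ i, ∑ j, x i * x j * B (EuclideanSpace.single i 1) (EuclideanSpace.single j 1) =
        ∑ i, ∑ j, x i * x j * B (EuclideanSpace.single j 1) (EuclideanSpace.single i 1) := by
      rw [Finset.sum_comm]
      exact Finset.sum_congr rfl fun i _ => Finset.sum_congr rfl fun j _ => by ring
    have goal : star x ⬝ᵥ (bilinMatrix B : Matrix (Fin n) (Fin n) ℝ).mulVec x =
        2⁻¹ * (∑ i, ∑ j, x i * x j * B (EuclideanSpace.single i 1) (EuclideanSpace.single j 1) +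
        ∑ i, ∑ j, x i * x j * B (EuclideanSpace.single j 1) (EuclideanSpace.single i 1)) := by
      simp only [dotProduct, Matrix.mulVec, bilinMatrix, LinearMap.coe_mk, AddHom.coe_mk,
        Matrix.smul_apply, Matrix.add_apply, Matrix.transpose_apply, Matrix.of_apply, smul_eq_mul,
        star_trivial, Finset.mul_sum, ← Finset.sum_add_distrib]
      exact Finset.sum_congr rfl fun i _ => Finset.sum_congr rfl fun j _ => by ring
    rw [goal, ← e', ← e]
    linarith

theorem hasFDerivAt_quadratic (c : ℝ) (b : Euc n) {B : Euc n →L[ℝ] Euc n →L[ℝ] ℝ}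
    (hB : ∀ v w, B v w = B w v) (x₀ x : Euc n) :
    HasFDerivAt (quadratic c b B x₀) (innerSL ℝ b + B (x - x₀)) x := by
  have d0 : HasFDerivAt (fun z => z - x₀) (ContinuousLinearMap.id ℝ (Euc n)) x :=
    (hasFDerivAt_id x).sub_const x₀
  have d1 : HasFDerivAt (fun z => innerSL ℝ b (z - x₀)) (innerSL ℝ b) x :=
    (innerSL ℝ b).hasFDerivAt.comp x d0
  have d2 := (B.hasFDerivAt.comp x d0).clm_apply d0
  refine ((d1.const_add c).add (d2.const_mul (2⁻¹ : ℝ))).congr_fderiv ?_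
  ext w
  simp [hB w]
  ring

theorem contDiff_quadratic (c : ℝ) (b : Euc n) (B : Euc n →L[ℝ] Euc n →L[ℝ] ℝ) (x₀ : Euc n) :
    ContDiff ℝ 2 (quadratic c b B x₀) := by
  have h : quadratic c b B x₀ = fun x => c + innerSL ℝ b (x - x₀) + 2⁻¹ * B (x - x₀) (x - x₀) :=
    rfl
  rw [h]
  fun_prop

theorem jet_quadratic (c : ℝ) (b : Euc n) {B : Euc n →L[ℝ] Euc n →L[ℝ] ℝ}
    (hB : ∀ v w, B v w = B w v) (x₀ : Euc n) :
    jet (quadratic c b B x₀) x₀ = (c, b, bilinMatrix B) := by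
  have h1 : fderiv ℝ (quadratic c b B x₀) = fun x => innerSL ℝ b + B (x - x₀) :=
    funext fun x => (hasFDerivAt_quadratic c b hB x₀ x).fderiv
  have h2 : fderiv ℝ (fun x => innerSL ℝ b + B (x - x₀)) x₀ = B := by
    have d0 : HasFDerivAt (fun z => z - x₀) (ContinuousLinearMap.id ℝ (Euc n)) x₀ :=
      (hasFDerivAt_id x₀).sub_const x₀
    exact ((B.hasFDerivAt.comp x₀ d0).const_add (innerSL ℝ b)).fderiv
  refine Prod.ext ?_ (Prod.ext ?_ ?_)
  · simp [jet, quadratic]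
  · simp only [jet, gradient, h1, sub_self, map_zero, add_zero]
    refine (InnerProductSpace.toDual ℝ (Euc n)).injective ?_
    rw [LinearIsometryEquiv.apply_symm_apply]
    rfl
  · simp only [jet, hessian_eq_bilinMatrix, h1, h2]

end Jets

/-! ### Monotonicity cones and duality. -/

section Cones

variable {n : ℕ} {F M : Set (Jet n)}

theorem IsConvexConeSubequation.add_mem (hM : IsConvexConeSubequation M) {J K : Jet n} (hJ : J ∈ M)
    (hK : K ∈ M) : J + K ∈ M := by
  have h := hM.cone 2 (by norm_num) _
    (hM.convex hJ hK (a := 2⁻¹) (b := 2⁻¹) (by norm_num) (by norm_num) (by norm_num))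
  rwa [← smul_add, smul_smul, mul_inv_cancel₀ (by norm_num), one_smul] at h

theorem IsConvexConeSubequation.interior_add_mem (hM : IsConvexConeSubequation M) {J K : Jet n}
    (hJ : J ∈ interior M) (hK : K ∈ M) : J + K ∈ interior M := by
  refine interior_maximal ?_ (isOpen_interior.add_right (s := interior M) (t := {K}))
    (Set.add_mem_add hJ rfl)
  rintro _ ⟨J, hJ, _, rfl, rfl⟩
  exact hM.add_mem (interior_subset hJ) hK

theorem IsConvexConeSubequation.smul_mem_interior (hM : IsConvexConeSubequation M) {J : Jet n}
    (hJ : J ∈ interior M) {t : ℝ} (ht : 0 < t) : t • J ∈ interior M := by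
  refine interior_maximal ?_ (isOpen_interior.smul₀ ht.ne') (Set.smul_mem_smul_set hJ)
  rintro _ ⟨J, hJ, rfl⟩
  exact hM.cone t ht.le J (interior_subset hJ)

/-- The cone contains the origin, to which negativity and positivity apply. -/
theorem IsConvexConeSubequation.mem_of_nonpos_of_posSemidef (hM : IsConvexConeSubequation M)
    {s : ℝ} (hs : s ≤ 0) {P : symMatrix n} (hP : (P : Matrix (Fin n) (Fin n) ℝ).PosSemidef) :
    ((s, 0, P) : Jet n) ∈ M := by
  obtain ⟨J, hJ⟩ := hM.subequation.nonempty
  have h0 : ((0, 0, 0) : Jet n) ∈ M := by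
    have := hM.cone 0 le_rfl J hJ
    rwa [zero_smul] at this
  have h1 := hM.subequation.pos _ _ _ _ (hM.subequation.neg _ _ _ _ h0 hs) hP
  rwa [zero_add, zero_add] at h1

/-- The algebraic core: F + Int M is open and contained in F, hence in Int F, whereas `K ∈ dual F`
means `-K ∉ interior F`. -/
theorem IsMonotoneFor.neg_add_notMem_interior (hFM : IsMonotoneFor F M) {J K : Jet n} (hJ : J ∈ F)
    (hK : K ∈ dual F) : -(J + K) ∉ interior M := by
  intro h
  have h1 : F + interior M ⊆ interior F :=
    interior_maximal ((Set.add_subset_add_left interior_subset).trans hFM) isOpen_interior.add_left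
  have h2 : -K ∉ interior F := hK
  refine h2 ?_
  have h3 := h1 (Set.add_mem_add hJ h)
  rwa [neg_add, add_neg_cancel_left] at h3

end Cones

/-! ### Contact jets read off hypographs. -/

section Hypograph

variable {n : ℕ} {F : Set (Jet n)} {Ω : Set (Euc n)} {u : Euc n → EReal} {x₀ : Euc n} {ρ : ℝ}

/-- The part of the hypograph of `u` over a closed ball. -/
def ballHypograph (u : Euc n → EReal) (x₀ : Euc n) (ρ : ℝ) : Set (Euc n × ℝ) :=
  {q | q.1 ∈ Metric.closedBall x₀ ρ ∧ (q.2 : EReal) ≤ u q.1}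

/-- Every larger bound is admitted so that two functions can share one. Points with value `⊥`
contribute nothing to the hypograph. -/
theorem IsUSC.exists_isBoundedHypograph {S : Set (Euc n)} (hu : IsUSC S u)
    (hS : Metric.closedBall x₀ ρ ⊆ S) {t : ℝ} (hρ : 0 ≤ ρ) (ht : (t : EReal) ≤ u x₀) :
    ∃ M₀, ∀ M, M₀ ≤ M → IsBoundedHypograph (ballHypograph u x₀ ρ) x₀ ρ M := by
  have husc : UpperSemicontinuousOn u (Metric.closedBall x₀ ρ) := fun x hx =>
    (hu.1 x (hS hx)).mono hS
  have hx₀ : x₀ ∈ Metric.closedBall x₀ ρ := Metric.mem_closedBall_self hρ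
  obtain ⟨z, hz, hmax⟩ := husc.exists_isMaxOn ⟨x₀, hx₀⟩ (isCompact_closedBall x₀ ρ)
  obtain ⟨M₀, hM₀, -⟩ := EReal.lt_iff_exists_real_btwn.1 (hu.2 z (hS hz))
  refine ⟨M₀, fun M hM => ⟨?_, ⟨(x₀, t), hx₀, ht⟩, ?_, ?_⟩⟩
  · exact ((upperSemicontinuousOn_iff_isClosed_hypograph Metric.isClosed_closedBall).1
      husc).preimage (continuous_fst.prodMk (continuous_coe_real_ereal.comp continuous_snd))
  · intro q hq
    simpa [dist_eq_norm] using hq.1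
  · intro q hq
    have h1 : (q.2 : EReal) ≤ u z := hq.2.trans (hmax hq.1)
    exact (EReal.coe_lt_coe_iff.1 (h1.trans_lt hM₀)).le.trans hM

/-- A quadratic polynomial touching the hypograph from above gives a jet in `F`. -/
theorem IsSubharmonicOn.mem_of_contact (hu : IsSubharmonicOn F Ω u)
    (hball : Metric.closedBall x₀ ρ ⊆ Ω) {q : Euc n × ℝ} (hq : q ∈ ballHypograph u x₀ ρ)
    (hqρ : ‖q.1 - x₀‖ < ρ) {p : Euc n} {B : Euc n →L[ℝ] Euc n →L[ℝ] ℝ} (hB : ∀ v w, B v w = B w v)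
    {ε : ℝ} (hle : ∀ᶠ y in 𝓝 q.1, ∀ t, (y, t) ∈ ballHypograph u x₀ ρ → t ≤ q.2 +
      (inner ℝ p (y - q.1) + 2⁻¹ * B (y - q.1) (y - q.1) + ε * ‖y - q.1‖ ^ 2)) :
    ((q.2, p, bilinMatrix (B + (2 * ε) • innerForm n)) : Jet n) ∈ F := by
  have hB' : ∀ v w, (B + (2 * ε) • innerForm n) v w =
      (B + (2 * ε) • innerForm n) w v := by
    intro v w
    simp [hB v w, innerForm_apply, real_inner_comm]
  have hquad : ∀ y, quadratic q.2 p (B + (2 * ε) • innerForm n) q.1 y = q.2 +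
      (inner ℝ p (y - q.1) + 2⁻¹ * B (y - q.1) (y - q.1) + ε * ‖y - q.1‖ ^ 2) := by
    intro y
    simp only [quadratic, add_apply, FunLike.coe_smul, Pi.smul_apply, innerForm_apply,
      real_inner_self_eq_norm_sq, smul_eq_mul]
    ring
  rw [← jet_quadratic q.2 p hB' q.1]
  have hreal : ∀ y, y ∈ Ω → ∀ s : ℝ, (∀ t : ℝ, (t : EReal) ≤ u y → t ≤ s) → u y ≤ s := by
    intro y hy s hs
    by_cases h : u y = ⊥
    · rw [h]
      exact bot_le
    · have e := EReal.coe_toReal (hu.1.2 y hy).ne h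
      rw [← e]
      exact EReal.coe_le_coe_iff.2 (hs _ e.le)
  have hnhds : ∀ᶠ y in 𝓝 q.1, y ∈ Metric.ball x₀ ρ :=
    Metric.isOpen_ball.mem_nhds (by simpa [dist_eq_norm] using hqρ)
  refine hu.2 q.1 (hball hq.1) _ ⟨(contDiff_quadratic _ _ _ _).contDiffAt, ?_, ?_⟩
  · filter_upwards [hle, hnhds] with y hy hyb
    have hyc := Metric.ball_subset_closedBall hyb
    refine hreal y (hball hyc) _ fun t ht => ?_
    rw [hquad]
    exact hy t ⟨hyc, ht⟩
  · rw [hquad]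
    have h0 := hle.self_of_nhds
    simp only [sub_self, inner_zero_right, map_zero, norm_zero, mul_zero, add_zero, ne_eq,
      OfNat.ofNat_ne_zero, not_false_eq_true, zero_pow] at h0 ⊢
    exact le_antisymm (hreal q.1 (hball hq.1) _ fun t ht => h0 t ⟨hq.1, ht⟩) hq.2

end Hypograph

/-! ### Subharmonic addition. -/

section Comparison

variable {n : ℕ} {F M : Set (Jet n)} {Ω : Set (Euc n)} {u v : Euc n → EReal} {x₀ : Euc n}

/-- The subharmonic addition theorem: the sum of an `F`-subharmonic and a `dual F`-subharmonic
function is `dual M`-subharmonic, tested with strictly touching quadratic polynomials. -/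
theorem neg_notMem_interior_of_touching (hM : IsConvexConeSubequation M)
    (hFM : IsMonotoneFor F M) (hΩ : IsOpen Ω) (hu : IsSubharmonicOn F Ω u)
    (hv : IsSubharmonicOn (dual F) Ω v) (hx₀ : x₀ ∈ Ω) {c : ℝ} {b : Euc n}
    {B : Euc n →L[ℝ] Euc n →L[ℝ] ℝ} (hB : ∀ v w, B v w = B w v) (hc : u x₀ + v x₀ = c)
    (hlt : ∀ᶠ x in 𝓝 x₀, x ≠ x₀ → u x + v x < (quadratic c b B x₀ x : ℝ)) :
    -((c, b, bilinMatrix B) : Jet n) ∉ interior M := by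
  intro hmem
  obtain ⟨t₁, ht₁⟩ : ∃ t : ℝ, u x₀ = t := by
    refine ⟨_, (EReal.coe_toReal (hu.1.2 x₀ hx₀).ne fun h => ?_).symm⟩
    rw [h] at hc
    simp at hc
  obtain ⟨t₂, ht₂⟩ : ∃ t : ℝ, v x₀ = t := by
    refine ⟨_, (EReal.coe_toReal (hv.1.2 x₀ hx₀).ne fun h => ?_).symm⟩
    rw [h] at hc
    simp at hc
  obtain ⟨ρ, hρ, hball⟩ := Metric.nhds_basis_closedBall.mem_iff.1
    (inter_mem (hΩ.mem_nhds hx₀) hlt)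
  have hballΩ : Metric.closedBall x₀ ρ ⊆ Ω := fun x hx => (hball hx).1
  obtain ⟨M₁, hM₁⟩ := hu.1.exists_isBoundedHypograph hballΩ hρ.le ht₁.ge
  obtain ⟨M₂, hM₂⟩ := hv.1.exists_isBoundedHypograph hballΩ hρ.le ht₂.ge
  have h₁ := hM₁ (max M₁ M₂) (le_max_left _ _)
  have h₂ := hM₂ (max M₁ M₂) (le_max_right _ _)
  let Q := quadratic c b B x₀
  -- Minus the jet of the tilted quadratic at a displaced point. The factor 4 counts the Hessian
  -- slack `2 * ε` once for `u` and once for `v`. By continuity `Φ` stays in Int M for small data.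
  let Φ : Euc n × Euc n × ℝ → Jet n := fun z =>
    -(Q z.1 + inner ℝ z.2.1 (z.1 - x₀),
      z.2.1 + (b + (InnerProductSpace.toDual ℝ (Euc n)).symm (B (z.1 - x₀))),
      bilinMatrix B + (4 * z.2.2) • bilinMatrix (innerForm n))
  have hΦ : Continuous Φ := by
    have hQ : Continuous Q := continuous_quadratic c b B x₀
    have hd := (InnerProductSpace.toDual ℝ (Euc n)).symm.continuous
    have hm : Continuous fun z : Euc n × Euc n × ℝ =>
        bilinMatrix B + (4 * z.2.2) • bilinMatrix (innerForm n) :=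
      continuous_const.add ((continuous_const.mul (continuous_snd.comp continuous_snd)).smul
        continuous_const)
    refine ((Continuous.prodMk ?_ (Continuous.prodMk ?_ hm))).neg
    · fun_prop
    · exact (continuous_fst.comp continuous_snd).add (continuous_const.add (hd.comp
        (B.continuous.comp (continuous_fst.sub continuous_const))))
  have hΦ₀ : Φ (x₀, 0, 0) ∈ interior M := by
    simpa [Φ, Q, quadratic] using hmem
  obtain ⟨r, hr, hrM⟩ := Metric.nhds_basis_ball.mem_iff.1
    (hΦ.continuousAt.preimage_mem_nhds (isOpen_interior.mem_nhds hΦ₀))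
  obtain ⟨x, p, p₁, p₂, B₁, B₂, q₁, q₂, hx, hp, hr₁, hr₂, hq₁, hq₂, hval, hgrad, hs₁, hs₂, hle, hT₁,
    hT₂⟩ := exists_contact_of_sum h₁ h₂ (c := c) (b := b) (B := B) hB (t₁ := t₁) (t₂ := t₂)
      ⟨Metric.mem_closedBall_self hρ.le, ht₁.ge⟩ ⟨Metric.mem_closedBall_self hρ.le, ht₂.ge⟩
      (by rw [ht₁, ht₂] at hc; exact_mod_cast hc)
      (by
        intro q₁ hq₁ q₂ hq₂ heq hne
        have h3 := (hball hq₁.1).2 hne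
        have h4 := hq₂.2
        rw [← heq] at h4
        exact_mod_cast (add_le_add hq₁.2 h4).trans_lt h3)
      (lt_min hr hρ)
  rw [lt_min_iff] at hx hp hr₁ hr₂
  have hF := hu.mem_of_contact hballΩ hq₁ hr₁.2 hs₁ (hT₁ (r / 2) (by positivity))
  have hF' := hv.mem_of_contact hballΩ hq₂ hr₂.2 hs₂ (hT₂ (r / 2) (by positivity))
  refine hFM.neg_add_notMem_interior hF hF' ?_
  have hz : Φ (x, p, r / 2) ∈ interior M := by
    refine hrM ?_
    rw [Metric.mem_ball, Prod.dist_eq, Prod.dist_eq, dist_eq_norm, dist_eq_norm, dist_eq_norm,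
      max_lt_iff, max_lt_iff]
    refine ⟨hx.1, by simpa using hp.1, ?_⟩
    rw [sub_zero, Real.norm_of_nonneg (by positivity)]
    linarith
  have hP : (bilinMatrix (B - B₁ - B₂) : Matrix (Fin n) (Fin n) ℝ).PosSemidef := by
    refine posSemidef_bilinMatrix fun w => ?_
    rw [sub_apply, sub_apply, sub_apply, sub_apply]
    linarith [hle w]
  have hs : Q x + inner ℝ p (x - x₀) - (q₁.2 + q₂.2) ≤ 0 := by linarith
  -- Minus the sum of the two contact jets is `Φ (x, p, r / 2)` plus an element of `M`: the value
  -- defect is nonpositive and `B - B₁ - B₂` is nonnegative.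
  have hfin := hM.interior_add_mem hz (hM.mem_of_nonpos_of_posSemidef hs hP)
  convert hfin using 1
  simp only [Φ]
  refine Prod.ext ?_ (Prod.ext ?_ ?_)
  · simp
    ring
  · simp only [Prod.snd_neg, Prod.fst_neg, Prod.snd_add, Prod.fst_add, hgrad, add_zero]
  · simp only [Prod.snd_neg, Prod.snd_add, map_add, bilinMatrix_sub, map_smul]
    module

end Comparison

/-! ### The strict approximator and comparison. -/

section Comparison

variable {n : ℕ} {F M : Set (Jet n)} {Ω : Set (Euc n)} {u v : Euc n → EReal}

/-- The sum of the two functions and a small multiple of a strict approximator has no maximum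
in `Ω` with a positive value. -/
theorem not_isMax_add_approximator (hM : IsConvexConeSubequation M)
    (hFM : IsMonotoneFor F M) (hΩ : IsOpen Ω) (hu : IsSubharmonicOn F Ω u)
    (hv : IsSubharmonicOn (dual F) Ω v) {ψ : Euc n → ℝ} (hψ : ContDiffOn ℝ 2 ψ Ω) {x₀ : Euc n}
    (hx₀ : x₀ ∈ Ω) (hjet : jet ψ x₀ ∈ interior M) {ε c : ℝ} (hε : 0 < ε) (hc : u x₀ + v x₀ = c)
    (hm : 0 ≤ c + ε * ψ x₀)
    (hmax : ∀ x ∈ Ω, u x + v x ≤ ((c + ε * ψ x₀ - ε * ψ x : ℝ) : EReal)) : False := by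
  have hcd : ContDiffAt ℝ 2 ψ x₀ := hψ.contDiffAt (hΩ.mem_nhds hx₀)
  have hd : ∀ᶠ y in 𝓝 x₀, HasFDerivAt ψ (fderiv ℝ ψ y) y := by
    filter_upwards [hΩ.mem_nhds hx₀] with y hy
    exact ((hψ.contDiffAt (hΩ.mem_nhds hy)).differentiableAt (by norm_num)).hasFDerivAt
  have hd2 : HasFDerivAt (fderiv ℝ ψ) (fderiv ℝ (fderiv ℝ ψ) x₀) x₀ :=
    ((hcd.fderiv_right (m := 1) (by norm_num)).differentiableAt (by norm_num)).hasFDerivAt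
  obtain ⟨D, hD⟩ : ∃ D, D = fderiv ℝ (fderiv ℝ ψ) x₀ := ⟨_, rfl⟩
  rw [← hD] at hd2
  have hDs : ∀ v w, D v w = D w v := second_derivative_symmetric_of_eventually hd hd2
  -- Openness leaves room for `η` in the Hessian. The touching quadratic gains `η / 2 * ‖x - x₀‖ ^
  -- 2`, while the Taylor error of `ε * ψ` costs at most `η / 4 * ‖x - x₀‖ ^ 2`, so touching becomes
  -- strict.
  obtain ⟨η, hη, hηM⟩ : ∃ η : ℝ, 0 < η ∧
      (ε • jet ψ x₀ + (-(c + ε * ψ x₀), 0, 0)) - ((0, 0, η • bilinMatrix (innerForm n)) : Jet n) ∈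
        interior M := by
    have h0 : ε • jet ψ x₀ + (-(c + ε * ψ x₀), 0, 0) ∈ interior M :=
      hM.interior_add_mem (hM.smul_mem_interior hjet hε)
        (hM.mem_of_nonpos_of_posSemidef (by linarith) (by exact Matrix.PosSemidef.zero))
    have hcont : Continuous fun η : ℝ => (ε • jet ψ x₀ + (-(c + ε * ψ x₀), 0, 0)) -
        ((0, 0, η • bilinMatrix (innerForm n)) : Jet n) :=
      continuous_const.sub (continuous_const.prodMk (continuous_const.prodMk
        (continuous_id.smul continuous_const)))
    have hev : ∀ᶠ η in 𝓝 (0 : ℝ), (ε • jet ψ x₀ + (-(c + ε * ψ x₀), 0, 0)) -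
        ((0, 0, η • bilinMatrix (innerForm n)) : Jet n) ∈ interior M := by
      refine hcont.continuousAt.eventually_mem (isOpen_interior.mem_nhds ?_)
      have e : ((0, 0, (0 : ℝ) • bilinMatrix (innerForm n)) : Jet n) = 0 := by
        rw [zero_smul]
        rfl
      rwa [e, sub_zero]
    obtain ⟨η, h1, h2⟩ := ((hev.filter_mono nhdsWithin_le_nhds).and
      (self_mem_nhdsWithin (s := Set.Ioi (0 : ℝ)))).exists
    exact ⟨η, h2, h1⟩
  refine neg_notMem_interior_of_touching hM hFM hΩ hu hv hx₀ (b := -(ε • gradient ψ x₀))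
    (B := η • innerForm n - ε • D) (fun v w => ?_) hc ?_ ?_
  · simp [hDs v w, innerForm_apply, real_inner_comm]
  · filter_upwards [hΩ.mem_nhds hx₀, taylor_two_isLittleO hd hd2 (ε := η / (4 * ε)) (by positivity)]
      with x hx hT hne
    refine (hmax x hx).trans_lt (EReal.coe_lt_coe_iff.2 ?_)
    have hpos : 0 < ‖x - x₀‖ := norm_pos_iff.2 (sub_ne_zero.2 hne)
    have h1 := mul_le_mul_of_nonneg_left (abs_le.1 hT).1 hε.le
    have h2 : ε * -(η / (4 * ε) * ‖x - x₀‖ ^ 2) = -(η / 4 * ‖x - x₀‖ ^ 2) := by field_simp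
    have h3 : inner ℝ (gradient ψ x₀) (x - x₀) = fderiv ℝ ψ x₀ (x - x₀) := by
      rw [gradient, InnerProductSpace.toDual_symm_apply]
    have h4 : 0 < η * ‖x - x₀‖ ^ 2 := by positivity
    simp only [quadratic, sub_apply, FunLike.coe_smul, Pi.smul_apply, smul_eq_mul, innerForm_apply,
      real_inner_self_eq_norm_sq, inner_neg_left, real_inner_smul_left, h3]
    linarith
  · convert hηM using 1
    refine Prod.ext ?_ (Prod.ext ?_ ?_)
    · simp [jet]
    · simp [jet]
    · simp [jet, hessian_eq_bilinMatrix, ← hD, bilinMatrix_sub, map_smul]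

theorem comparison_add (hM : IsConvexConeSubequation M)
    (hFM : IsMonotoneFor F M) (hΩ : IsOpen Ω) (hΩb : Bornology.IsBounded Ω)
    {ψ : Euc n → ℝ} (hψ : IsStrictApproximator M Ω ψ)
    (huc : IsUSC (closure Ω) u) (hvc : IsUSC (closure Ω) v) (hu : IsSubharmonicOn F Ω u)
    (hv : IsSubharmonicOn (dual F) Ω v) (hbd : ∀ x ∈ frontier Ω, u x + v x ≤ 0) :
    ∀ x ∈ Ω, u x + v x ≤ 0 := by
  intro x₁ hx₁
  by_contra! hpos
  have hcomp : IsCompact (closure Ω) := hΩb.isCompact_closure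
  obtain ⟨C, hC⟩ := hcomp.exists_bound_of_continuousOn hψ.1
  have hC0 : 0 ≤ C := (norm_nonneg _).trans (hC x₁ (subset_closure hx₁))
  have htop : ∀ x ∈ closure Ω, u x + v x ≠ ⊤ := fun x hx =>
    (EReal.add_lt_top (huc.2 x hx).ne (hvc.2 x hx).ne).ne
  obtain ⟨a, ha⟩ : ∃ a : ℝ, u x₁ + v x₁ = a :=
    ⟨_, (EReal.coe_toReal (htop x₁ (subset_closure hx₁)) (EReal.bot_lt_zero.trans hpos).ne').symm⟩
  have ha0 : 0 < a := by
    rw [ha] at hpos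
    exact_mod_cast hpos
  -- With `|ψ| ≤ C`, passing from `x₁` to the maximum point changes `ε * ψ` by at most `2 * (ε * C)
  -- < a`. So u + v stays positive there, which excludes the frontier.
  obtain ⟨ε, hε⟩ : ∃ ε, ε = a / (2 * C + 1) / 2 := ⟨_, rfl⟩
  have hε0 : 0 < ε := by rw [hε]; positivity
  have hεC : 2 * (ε * C) < a := by
    have h1 : ε * (2 * (2 * C + 1)) = a := by rw [hε]; field_simp
    nlinarith
  have hsc : UpperSemicontinuousOn (fun x => (u x + v x) + ((ε * ψ x : ℝ) : EReal)) (closure Ω) := by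
    refine (huc.1.add' hvc.1 fun x hx => EReal.continuousAt_add (.inl (huc.2 x hx).ne)
      (.inr (hvc.2 x hx).ne)).add' ?_ fun x hx => EReal.continuousAt_add (.inl (htop x hx))
      (.inr (EReal.coe_ne_top _))
    exact (continuous_coe_real_ereal.comp_continuousOn
      (continuousOn_const.mul hψ.1)).upperSemicontinuousOn
  obtain ⟨x₀, hx₀, hmax⟩ := hsc.exists_isMaxOn ⟨x₁, subset_closure hx₁⟩ hcomp
  have hψle : ∀ x ∈ closure Ω, |ε * ψ x| ≤ ε * C := by
    intro x hx
    rw [abs_mul, abs_of_pos hε0]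
    exact mul_le_mul_of_nonneg_left (hC x hx) hε0.le
  have h₁ : ((a + ε * ψ x₁ : ℝ) : EReal) ≤ (u x₀ + v x₀) + ((ε * ψ x₀ : ℝ) : EReal) := by
    have := hmax (subset_closure hx₁)
    simp only [Set.mem_ofPred_eq, ha] at this
    exact_mod_cast this
  obtain ⟨c, hc⟩ : ∃ c : ℝ, u x₀ + v x₀ = c := by
    refine ⟨_, (EReal.coe_toReal (htop x₀ hx₀) fun h => ?_).symm⟩
    rw [h, EReal.bot_add] at h₁
    exact absurd h₁ (not_le.2 (EReal.bot_lt_coe _))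
  have h₂ : a + ε * ψ x₁ ≤ c + ε * ψ x₀ := by
    rw [hc] at h₁
    exact_mod_cast h₁
  have b₁ := (abs_le.1 (hψle x₁ (subset_closure hx₁))).1
  have b₀ := (abs_le.1 (hψle x₀ hx₀)).2
  have hx₀Ω : x₀ ∈ Ω := by
    by_contra hnot
    have hfr : x₀ ∈ frontier Ω := by
      rw [hΩ.frontier_eq]
      exact ⟨hx₀, hnot⟩
    have := hbd x₀ hfr
    rw [hc] at this
    have hc0 : c ≤ 0 := by exact_mod_cast this
    linarith
  refine not_isMax_add_approximator hM hFM hΩ hu hv hψ.2.1 hx₀Ω (hψ.2.2 x₀ hx₀Ω) hε0 hc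
    (by linarith) fun x hx => ?_
  have h₃ : (u x + v x) + ((ε * ψ x : ℝ) : EReal) ≤ (c : EReal) + ((ε * ψ x₀ : ℝ) : EReal) := by
    have := hmax (subset_closure hx)
    simp only [Set.mem_ofPred_eq, hc] at this
    exact this
  rw [EReal.coe_sub, EReal.coe_add]
  exact (EReal.le_sub_iff_add_le (.inl (EReal.coe_ne_bot _)) (.inl (EReal.coe_ne_top _))).2 h₃

theorem IsLSC.neg {S : Set (Euc n)} {w : Euc n → EReal} (hw : IsLSC S w) :
    IsUSC S fun x => -w x := by
  refine ⟨?_, fun x hx => ?_⟩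
  · exact continuous_neg.comp_lowerSemicontinuousOn_antitone hw.1 fun _ _ h =>
      EReal.neg_le_neg_iff.2 h
  · rw [lt_top_iff_ne_top, Ne, EReal.neg_eq_top_iff]
    exact (hw.2 x hx).ne'

end Comparison

end JetTheory

theorem mainTheorem2 {n : ℕ} (F M : Set (JetTheory.Jet n))
    (hF : JetTheory.IsSubequation F) (hM : JetTheory.IsConvexConeSubequation M)
    (hFM : JetTheory.IsMonotoneFor F M)
    (Ω : Set (JetTheory.Euc n)) (hΩ_open : IsOpen Ω) (hΩ_bdd : Bornology.IsBounded Ω)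
    (hψ : ∃ ψ : JetTheory.Euc n → ℝ, JetTheory.IsStrictApproximator M Ω ψ) :
    (∀ u v : JetTheory.Euc n → EReal,
      JetTheory.IsUSC (closure Ω) u → JetTheory.IsUSC (closure Ω) v →
      JetTheory.IsSubharmonicOn F Ω u → JetTheory.IsSubharmonicOn (JetTheory.dual F) Ω v →
      (∀ x ∈ frontier Ω, u x + v x ≤ 0) → ∀ x ∈ Ω, u x + v x ≤ 0) ∧
    (∀ u w : JetTheory.Euc n → EReal,
      JetTheory.IsUSC (closure Ω) u → JetTheory.IsLSC (closure Ω) w →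
      JetTheory.IsSubharmonicOn F Ω u → JetTheory.IsSuperharmonicOn F Ω w →
      (∀ x ∈ frontier Ω, u x ≤ w x) → ∀ x ∈ Ω, u x ≤ w x) := by
  obtain ⟨ψ, hψ⟩ := hψ
  refine ⟨fun u v huc hvc hu hv hbd =>
    JetTheory.comparison_add hM hFM hΩ_open hΩ_bdd hψ huc hvc hu hv hbd,
    fun u w huc hwc hu hw hbd x hx => ?_⟩
  -- This needs no finiteness, since `⊥ + ⊤ = ⊥` in `EReal`.
  have hiff : ∀ x ∈ closure Ω, u x + -w x ≤ 0 ↔ u x ≤ w x := by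
    intro x hx
    rw [← sub_eq_add_neg]
    exact EReal.sub_nonpos
  exact (hiff x (subset_closure hx)).1 (JetTheory.comparison_add hM hFM hΩ_open hΩ_bdd hψ huc hwc.neg
    hu hw (fun y hy => (hiff y (frontier_subset_closure hy)).2 (hbd y hy)) x hx)
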